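/- **Setting.** For each $n$ consider a dynamic panel $y_{i,t}=z_{i,t}'\alpha+\eta_i+\varepsilon_{i,t}$, $i=1,\dots,N$, $t=1,\dots,T$, with regressors $z_{i,t}=(y_{i,t-1},\dots,y_{i,t-L},x_{i,t}')'\in\mathbb R^p$, $p=L+p_x\ge 2$, random initial observations $y_{i,0},\dots,y_{i,1-L}$ and fixed real parameters $\alpha,\eta_i$. All of $N,T\ge1$, $L\ge 0$, $p_x\ge 0$, the parameters and the distributions may depend on $n$, and $N\to\infty$ as $n\to\infty$; all $O$, $O_p$ statements are for $n\to\infty$. Let $Z$ be the $NT\times p$ matrix with rows $z_{i,t}'$, $z_j$ its $j$th column and $Z_{-j}$ the matrix of the other columns; $z_{i,t,-j}$ is $z_{i,t}$ without its $j$th entry. Put $\Psi_Z=\frac1{NT}\sum_{i,t}\mathbb E[z_{i,t}z_{i,t}']$, $\Theta_Z=\Psi_Z^{-1}$ with $j$th row $\Theta_{Z,j}$, $\phi_j=\arg\min_\delta\frac1{NT}\sum_{i,t}\mathbb E[(z_{i,t,j}-z_{i,t,-j}'\delta)^2]$, $\zeta_{j,i,t}=z_{i,t,j}-z_{i,t,-j}'\phi_j$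 and $\tau_j^2=\mathbb E\big[\frac1{NT}\sum_{i,t}\zeta_{j,i,t}^2\big]$. For $\lambda_{node}>0$ let $\hat\phi_j\in\mathbb R^{p-1}$ be any minimizer of $\delta\mapsto\frac1{NT}\|z_j-Z_{-j}\delta\|^2+2\lambda_{node}\|\delta\|_1$, let $\hat\tau_j^2=\frac1{NT}\|z_j-Z_{-j}\hat\phi_j\|^2+\lambda_{node}\|\hat\phi_j\|_1$, and $\hat\Theta_{Z,j}=\hat C_j/\hat\tau_j^2$, where $\hat C_j\in\mathbb R^p$ has $j$th entry $1$ and remaining entries $-\hat\phi_j$. Let $H_1\subseteq\{1,\dots,p\}$ be nonempty (possibly depending on $n$). **Assumptions.** 1. The vectors $(y_{i,0},\dots,y_{i,1-L},x_{i,1}',\dots,x_{i,T}',\varepsilon_{i,1},\dots,\varepsilon_{i,T})$, $i=1,\dots,N$, are independent, and $\mathbb E[\varepsilon_{i,t}\mid y_{i,t-1},\dots,y_{i,1-L},x_{i,t},\dots,x_{i,1}]=0$ for all $i,t$. 2. There are constants $C,K>0$, not depending on $n$, such that $\mathbb P(|X|\ge\epsilon)\le\frac12Ke^{-C\epsilon^2}$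 for all $\epsilon\ge0$ and every $X$ among the $\varepsilon_{i,t}$ and $z_{i,t,l}$; likewise (with possibly other constants) for every $X$ among the $\zeta_{j,i,t}$, $j=1,\dots,p$. 3. The smallest eigenvalue of $\Psi_Z$ is bounded away from $0$ and its largest eigenvalue is bounded above, uniformly in $n$. 4. (Weak sparsity.) For a fixed $\vartheta\in(0,1)$ and numbers $G_j>0$, $\sum_{k}|\phi_{j,k}|^\vartheta\le G_j$ for $j\in H_1$. With $\bar G=\max_{j\in H_1}G_j$ one has $\bar G\lambda_{node}^{1-\vartheta}=O(1)$ and $\lambda_{node}^{\vartheta}=O(\bar G)$. **Lemma.** Let these assumptions hold, with $\lambda_{node}=\sqrt{16M(\log p)^3/N}$. Then for all sufficiently large constants $M$: $\mathbb P(\min_{j\in H_1}\hat\tau_j^2>0)\to1$ and $$\max_{j\in H_1}|\hat\tau_j^2-\tau_j^2|=O_p\Big(\bar G^{1/2}\Big[\tfrac{(\log p)^3}{N}\Big]^{\frac{2-\vartheta}4}\Big),\qquad \max_{j\in H_1}\frac1{\hat\tau_j^2}=O_p(1),$$ $$\max_{j\in H_1}\Big|\frac1{\hat\tau_j^2}-\frac1{\tau_j^2}\Big|=O_p\Big(\bar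 G^{1/2}\Big[\tfrac{(\log p)^3}{N}\Big]^{\frac{2-\vartheta}4}\Big),\qquad \max_{j\in H_1}\|\hat\Theta_{Z,j}-\Theta_{Z,j}\|_1=O_p\Big(\bar G\Big[\tfrac{(\log p)^3}{N}\Big]^{\frac{1-\vartheta}2}\Big),$$ $$\max_{j\in H_1}\|\hat\Theta_{Z,j}-\Theta_{Z,j}\|_2=O_p\Big(\bar G^{1/2}\Big[\tfrac{(\log p)^3}{N}\Big]^{\frac{2-\vartheta}4}\Big),\qquad \max_{j\in H_1}\|\hat\Theta_{Z,j}\|_1=O_p\Big(\bar G^{1/2}\Big[\tfrac{(\log p)^3}{N}\Big]^{-\frac{\vartheta}4}\Big).$$ -/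

import Mathlib

open MeasureTheory ProbabilityTheory Filter Topology Asymptotics

noncomputable section

/-- A dynamic panel data set on a sample space `Ω`, with `N` individuals, `T` periods, `L` lags
and `px` further covariates. The index `t : Fin T` stands for the calendar period `t + 1`;
`y i s` is the outcome of individual `i` in period `s`, only the periods
`1 - L, …, T` being relevant, and the initial observations are those in periods `1 - L, …, 0`. -/
structure DynamicPanel (Ω : Type*) [MeasurableSpace Ω] where
  N : ℕ
  T : ℕ
  L : ℕ
  px : ℕ
  N_pos : 0 < N
  T_pos : 0 < T
  y : Fin N → ℤ → Ω → ℝ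
  x : Fin N → Fin T → Fin px → Ω → ℝ
  ε : Fin N → Fin T → Ω → ℝ
  /-- coefficients of the lagged outcomes and of the covariates -/
  α : Fin L ⊕ Fin px → ℝ
  /-- fixed effects -/
  η : Fin N → ℝ
  measurable_initial : ∀ i (l : Fin L), Measurable (y i (-(l : ℤ)))
  measurable_x : ∀ i t k, Measurable (x i t k)
  measurable_ε : ∀ i t, Measurable (ε i t)
  /-- the model equation `y_{i,t} = ∑_l α_l y_{i,t-l} + β' x_{i,t} + η_i + ε_{i,t}` -/
  model : ∀ i (t : Fin T) ω,
    y i ((t : ℤ) + 1) ω =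
      ∑ l : Fin L, α (Sum.inl l) * y i ((t : ℤ) + 1 - ((l : ℤ) + 1)) ω
        + ∑ k : Fin px, α (Sum.inr k) * x i t k ω + η i + ε i t ω

namespace DynamicPanel

variable {Ω : Type*} [MeasurableSpace Ω]

/-- Index set of the `p = L + px` regressors `z_{i,t} = (y_{i,t-1}, …, y_{i,t-L}, x_{i,t}')'`. -/
abbrev Idx (P : DynamicPanel Ω) : Type := Fin P.L ⊕ Fin P.px

/-- The number of regressors. -/
def p (P : DynamicPanel Ω) : ℕ := P.L + P.px

/-- All regressor indices except `j`. -/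
abbrev Others (P : DynamicPanel Ω) (j : P.Idx) : Type := {k : P.Idx // k ≠ j}

/-- The regressor vector `z_{i,t}`. -/
def z (P : DynamicPanel Ω) (i : Fin P.N) (t : Fin P.T) : P.Idx → Ω → ℝ
  | Sum.inl l => P.y i ((t : ℤ) + 1 - ((l : ℤ) + 1))
  | Sum.inr k => P.x i t k

/-- The `i`th block: initial observations, covariates and errors of individual `i`. -/
def block (P : DynamicPanel Ω) (i : Fin P.N) (ω : Ω) :
    (Fin P.L → ℝ) × (Fin P.T → Fin P.px → ℝ) × (Fin P.T → ℝ) :=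
  (fun l => P.y i (-(l : ℤ)) ω, fun t k => P.x i t k ω, fun t => P.ε i t ω)

/-- The σ-algebra generated by `y_{i,t-1}, …, y_{i,1-L}, x_{i,t}, …, x_{i,1}`
(`t : Fin T` standing for period `t + 1`). -/
@[reducible] def history (P : DynamicPanel Ω) (i : Fin P.N) (t : Fin P.T) : MeasurableSpace Ω :=
  (⨆ s ∈ Set.Icc (1 - (P.L : ℤ)) (t : ℤ), MeasurableSpace.comap (P.y i s) inferInstance) ⊔
    ⨆ s ∈ Set.Iic t, ⨆ k : Fin P.px, MeasurableSpace.comap (P.x i s k) inferInstance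

/-- Independence across individuals and predeterminedness of the regressors. -/
structure PanelAssumption (P : DynamicPanel Ω) (μ : Measure Ω) : Prop where
  indep : iIndepFun P.block μ
  mds : ∀ i t, μ[P.ε i t | P.history i t] =ᵐ[μ] 0

/-- The population second moment matrix `Ψ_Z`. -/
def PsiZ (P : DynamicPanel Ω) (μ : Measure Ω) : Matrix P.Idx P.Idx ℝ :=
  Matrix.of fun k l =>
    1 / ((P.N : ℝ) * P.T) * ∑ i, ∑ t, ∫ ω, P.z i t k ω * P.z i t l ω ∂μ

/-- `Θ_Z = Ψ_Z⁻¹`. -/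
def ThetaZ (P : DynamicPanel Ω) (μ : Measure Ω) : Matrix P.Idx P.Idx ℝ := (P.PsiZ μ)⁻¹

/-- The residual `z_{i,t,j} - z_{i,t,-j}' δ`. -/
def resid (P : DynamicPanel Ω) (j : P.Idx) (δ : P.Others j → ℝ)
    (i : Fin P.N) (t : Fin P.T) (ω : Ω) : ℝ :=
  P.z i t j ω - ∑ k : P.Others j, P.z i t k.1 ω * δ k

/-- The population least squares criterion of the `j`th nodewise regression. -/
def popRisk (P : DynamicPanel Ω) (μ : Measure Ω) (j : P.Idx) (δ : P.Others j → ℝ) : ℝ :=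
  1 / ((P.N : ℝ) * P.T) * ∑ i, ∑ t, ∫ ω, P.resid j δ i t ω ^ 2 ∂μ

/-- `φ_j`, the minimizer of the population criterion. -/
def phi (P : DynamicPanel Ω) (μ : Measure Ω) (j : P.Idx) : P.Others j → ℝ :=
  Classical.epsilon fun δ => ∀ δ', P.popRisk μ j δ ≤ P.popRisk μ j δ'

/-- `ζ_{j,i,t} = z_{i,t,j} - z_{i,t,-j}' φ_j`. -/
def zeta (P : DynamicPanel Ω) (μ : Measure Ω) (j : P.Idx) (i : Fin P.N) (t : Fin P.T) (ω : Ω) :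
    ℝ :=
  P.resid j (P.phi μ j) i t ω

/-- `τ_j²`. -/
def tauSq (P : DynamicPanel Ω) (μ : Measure Ω) (j : P.Idx) : ℝ :=
  ∫ ω, 1 / ((P.N : ℝ) * P.T) * ∑ i, ∑ t, P.zeta μ j i t ω ^ 2 ∂μ

/-- `‖z_j - Z_{-j} δ‖² / (NT)`. -/
def empRisk (P : DynamicPanel Ω) (j : P.Idx) (ω : Ω) (δ : P.Others j → ℝ) : ℝ :=
  1 / ((P.N : ℝ) * P.T) * ∑ i, ∑ t, P.resid j δ i t ω ^ 2

/-- `δ` is a nodewise Lasso estimate for index `j` at the sample point `ω`: it minimizes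
`‖z_j - Z_{-j} δ‖² / (NT) + 2 lam ‖δ‖₁`. -/
def IsNodewiseLasso (P : DynamicPanel Ω) (lam : ℝ) (j : P.Idx) (ω : Ω)
    (δ : P.Others j → ℝ) : Prop :=
  ∀ δ' : P.Others j → ℝ,
    P.empRisk j ω δ + 2 * lam * ∑ k, |δ k| ≤ P.empRisk j ω δ' + 2 * lam * ∑ k, |δ' k|

/-- `τ̂_j²`, computed from the nodewise estimate `δ`. -/
def tauHatSq (P : DynamicPanel Ω) (lam : ℝ) (j : P.Idx) (ω : Ω) (δ : P.Others j → ℝ) : ℝ :=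
  P.empRisk j ω δ + lam * ∑ k, |δ k|

/-- `Ĉ_j`, the vector with `j`th entry `1` and other entries `-δ`. -/
def CRow (P : DynamicPanel Ω) (j : P.Idx) (δ : P.Others j → ℝ) (k : P.Idx) : ℝ :=
  if h : k = j then 1 else -δ ⟨k, h⟩

/-- `Θ̂_{Z,j} = Ĉ_j / τ̂_j²`. -/
def ThetaHat (P : DynamicPanel Ω) (lam : ℝ) (j : P.Idx) (ω : Ω) (δ : P.Others j → ℝ)
    (k : P.Idx) : ℝ :=
  P.CRow j δ k / P.tauHatSq lam j ω δ

end DynamicPanel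

/-- `P(|X| ≥ e) ≤ (K / 2) exp (-C e²)` for every `e ≥ 0`. -/
def SubgaussianTail {Ω : Type*} [MeasurableSpace Ω] (μ : Measure Ω) (X : Ω → ℝ) (C K : ℝ) : Prop :=
  ∀ e : ℝ, 0 ≤ e → μ.real {ω | e ≤ |X ω|} ≤ 1 / 2 * K * Real.exp (-C * e ^ 2)

/-- Smallest eigenvalue (of a symmetric matrix). -/
def mineval {ι : Type*} [Fintype ι] [DecidableEq ι] (A : Matrix ι ι ℝ) : ℝ := sInf (spectrum ℝ A)

/-- Largest eigenvalue (of a symmetric matrix). -/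
def maxeval {ι : Type*} [Fintype ι] [DecidableEq ι] (A : Matrix ι ι ℝ) : ℝ := sSup (spectrum ℝ A)

/-- `ℓ₁` norm. -/
def l1norm {ι : Type*} [Fintype ι] (v : ι → ℝ) : ℝ := ∑ k, |v k|

/-- `ℓ₂` norm. -/
def l2norm {ι : Type*} [Fintype ι] (v : ι → ℝ) : ℝ := Real.sqrt (∑ k, v k ^ 2)

/-- `X_n = O_p(r_n)`. No measurability of `X_n` is required: `μ n` is then the outer measure. -/
def IsBigOp {Ω : ℕ → Type*} [∀ n, MeasurableSpace (Ω n)] (μ : ∀ n, Measure (Ω n))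
    (X : ∀ n, Ω n → ℝ) (r : ℕ → ℝ) : Prop :=
  ∀ ε : ℝ, 0 < ε → ∃ B : ℝ, 0 < B ∧
    ∀ᶠ n in atTop, μ n {ω | B * r n < |X n ω|} ≤ ENNReal.ofReal ε

/-- The ratio `(log p)³ / N`. -/
def logRatio (p N : ℕ) : ℝ := Real.log p ^ 3 / N

/-- `λ_node = √(16 M (log p)³ / N)`. -/
def lambdaNode (M : ℝ) (p N : ℕ) : ℝ := Real.sqrt (16 * M * Real.log p ^ 3 / N)

end

/-! The argument is the standard Lasso oracle analysis, reduced to one random event. On that event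
every pooled sample moment of pairs taken from the regressors `z_k` and the nodewise errors `ζ_j` is
within `u = A √(log p / N)` of its expectation. Time averages within an individual inherit
exponential moments by Jensen, so no restriction on serial dependence is needed. Bernstein's
inequality over the independent individuals and a union bound over `(2p)²` pairs then make the event
likely (`exists_measure_not_momentsClose_le`). Keeping the `ζ_j` in the list controls the Lasso
score and the empirical risk at `φ_j` without a factor `‖φ_j‖₁`.

On this event everything is deterministic. Let `Γ² = Gbar λ^(-ϑ)` be the effective sparsity. The
growth conditions say that `Γ² λ` is bounded above and `Γ` bounded below. Coefficients above `λ`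
number at most `Γ²`, and the others have `ℓ₁` mass at most `Γ² λ`. So, if `u ≤ λ/4`, the basic
inequality puts the error `φ̂_j - φ_j` in an approximate cone (`lasso_cone`). The smallest
eigenvalue of `Ψ_Z` passes to the sample matrix on that cone when `u Γ²` is small, which gives `ℓ₂`
error of order `Γ λ` and `ℓ₁` error of order `Γ² λ` (`exists_lasso_bounds`). Since `Θ_{Z,j}` is `(1,
-φ_j)` divided by `τ_j²`, the rates carry over to its rows. Because `Γ λ` need not tend to zero,
`τ̂_j²` is bounded below directly by the eigenvalue bound at `(1, -φ̂_j)`, not by consistency.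

The penalty exceeds `u` by a factor proportional to `log p`. If `log p` is large, the penalty
dominates the noise as above. Otherwise `p` is bounded, the `ℓ₁` and `ℓ₂` norms are comparable, no
cone is needed, and `u → 0` because `N → ∞`. Splitting at a threshold on `log p` covers every
sequence of dimensions and every `M > 0`, with constants that depend on `M`. -/

/-- A bound for `E exp (C X² / 4)` when `X` has the tail `(K / 2) exp (-C e²)`. -/
noncomputable def expSqBound (C K : ℝ) : ℝ :=
  Real.exp (C / 2) * (K / 2) * ∑' m : ℕ, Real.exp (-(C / 2) * m)

/-! ### Exponential moments and Bernstein's inequality. -/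

section Tails

variable {Ω : Type*} [MeasurableSpace Ω] {μ : Measure Ω} {X Y V : Ω → ℝ} {C K : ℝ}

theorem SubgaussianTail.mono {C' K' : ℝ} (h : SubgaussianTail μ X C K) (hC : C' ≤ C) (hK : K ≤ K')
    (hK0 : 0 ≤ K) : SubgaussianTail μ X C' K' := by
  intro e he
  have hK' : 0 ≤ K' := hK0.trans hK
  refine (h e he).trans ?_
  gcongr

theorem summable_exp_neg_half_mul (hC : 0 < C) :
    Summable fun m : ℕ => Real.exp (-(C / 2) * m) := by
  have := Real.summable_exp_nat_mul_iff (a := -(C / 2))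
  simpa [mul_comm] using this.2 (by linarith)

theorem expSqBound_nonneg (hK : 0 < K) : 0 ≤ expSqBound C K := by
  unfold expSqBound
  have : 0 ≤ ∑' m : ℕ, Real.exp (-(C / 2) * m) := tsum_nonneg fun _ => (Real.exp_pos _).le
  positivity

/-- The range of `|X|` is cut at the integers: on the shell with floor `m` the integrand is at most
`exp (C (m+1)² / 4)`, while the tail contributes `exp (-C m²)`, so the shells sum geometrically. -/
theorem SubgaussianTail.lintegral_exp_sq_le [IsFiniteMeasure μ] (hC : 0 < C) (hK : 0 < K)
    (h : SubgaussianTail μ X C K) (hX : Measurable X) :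
    ∫⁻ ω, ENNReal.ofReal (Real.exp (C / 4 * X ω ^ 2)) ∂μ ≤ ENNReal.ofReal (expSqBound C K) := by
  have hmeas : ∀ m : ℕ, MeasurableSet {ω | (m : ℝ) ≤ |X ω|} := fun m =>
    measurableSet_le measurable_const hX.abs
  calc ∫⁻ ω, ENNReal.ofReal (Real.exp (C / 4 * X ω ^ 2)) ∂μ
      ≤ ∫⁻ ω, ∑' m : ℕ, Set.indicator {ω | (m : ℝ) ≤ |X ω|}
          (fun _ => ENNReal.ofReal (Real.exp (C / 4 * (m + 1) ^ 2))) ω ∂μ := by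
        refine lintegral_mono fun ω => ?_
        refine le_trans ?_ (ENNReal.le_tsum ⌊|X ω|⌋₊)
        rw [Set.indicator_of_mem (by exact Nat.floor_le (abs_nonneg (X ω)))]
        refine ENNReal.ofReal_le_ofReal (Real.exp_le_exp.2 ?_)
        rw [← sq_abs]
        have := (Nat.lt_floor_add_one |X ω|).le
        gcongr
    _ = ∑' m : ℕ, ENNReal.ofReal (Real.exp (C / 4 * (m + 1) ^ 2)) * μ {ω | (m : ℝ) ≤ |X ω|} := by
        rw [lintegral_tsum fun m => (measurable_const.indicator (hmeas m)).aemeasurable]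
        simp_rw [lintegral_indicator_const (hmeas _)]
    _ ≤ ∑' m : ℕ, ENNReal.ofReal (Real.exp (C / 2) * (K / 2) * Real.exp (-(C / 2) * m)) := by
        refine ENNReal.tsum_le_tsum fun m => ?_
        rw [← ENNReal.ofReal_toReal (measure_ne_top μ {ω | (m : ℝ) ≤ |X ω|}),
          ← ENNReal.ofReal_mul (Real.exp_pos _).le]
        refine ENNReal.ofReal_le_ofReal ?_
        have h1 := h m (Nat.cast_nonneg m)
        have h2 : (m : ℝ) ≤ (m : ℝ) ^ 2 := by
          exact_mod_cast Nat.le_self_pow (by norm_num) m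
        calc Real.exp (C / 4 * (m + 1) ^ 2) * (μ {ω | (m : ℝ) ≤ |X ω|}).toReal
            ≤ Real.exp (C / 4 * (m + 1) ^ 2) * (1 / 2 * K * Real.exp (-C * m ^ 2)) := by
              gcongr
              exact h1
          _ = (K / 2) * Real.exp (C / 4 * (m + 1) ^ 2 + -C * m ^ 2) := by
              rw [Real.exp_add]; ring
          _ ≤ (K / 2) * Real.exp (C / 2 + -(C / 2) * m) := by
              -- The difference of the exponents is `C ((m-1)²/4 + (m² - m)/2)`, nonnegative because
              -- `m² ≥ m` for a natural number.
              refine mul_le_mul_of_nonneg_left (Real.exp_le_exp.2 ?_) (by positivity)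
              nlinarith [mul_nonneg hC.le (sub_nonneg.2 h2),
                mul_nonneg hC.le (sq_nonneg ((m : ℝ) - 1))]
          _ = _ := by rw [Real.exp_add]; ring
    _ = ENNReal.ofReal (expSqBound C K) := by
        rw [← ENNReal.ofReal_tsum_of_nonneg (fun m => by positivity)
          ((summable_exp_neg_half_mul hC).mul_left _), tsum_mul_left]
        rfl

theorem SubgaussianTail.integrable_exp_sq [IsFiniteMeasure μ] (hC : 0 < C) (hK : 0 < K)
    (h : SubgaussianTail μ X C K) (hX : Measurable X) :
    Integrable (fun ω => Real.exp (C / 4 * X ω ^ 2)) μ := by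
  refine ⟨(by fun_prop : Measurable fun ω => Real.exp (C / 4 * X ω ^ 2)).aestronglyMeasurable, ?_⟩
  rw [hasFiniteIntegral_iff_ofReal (ae_of_all _ fun _ => (Real.exp_pos _).le)]
  exact (h.lintegral_exp_sq_le hC hK hX).trans_lt ENNReal.ofReal_lt_top

theorem SubgaussianTail.integral_exp_sq_le [IsFiniteMeasure μ] (hC : 0 < C) (hK : 0 < K)
    (h : SubgaussianTail μ X C K) (hX : Measurable X) :
    ∫ ω, Real.exp (C / 4 * X ω ^ 2) ∂μ ≤ expSqBound C K := by
  rw [integral_eq_lintegral_of_nonneg_ae (ae_of_all _ fun _ => (Real.exp_pos _).le)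
    (h.integrable_exp_sq hC hK hX).1]
  exact ENNReal.toReal_le_of_le_ofReal (expSqBound_nonneg hK) (h.lintegral_exp_sq_le hC hK hX)

theorem exp_mul_abs_mul_le {c x y : ℝ} (hc : 0 ≤ c) :
    Real.exp (c * |x * y|) ≤ (Real.exp (c * x ^ 2) + Real.exp (c * y ^ 2)) / 2 := by
  have h1 : c * |x * y| ≤ (c * x ^ 2 + c * y ^ 2) / 2 := by
    rw [abs_mul]
    nlinarith [mul_nonneg hc (sq_nonneg (|x| - |y|)), sq_abs x, sq_abs y]
  refine (Real.exp_le_exp.2 h1).trans ?_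
  have h2 : Real.exp ((c * x ^ 2 + c * y ^ 2) / 2) ^ 2
      = Real.exp (c * x ^ 2) * Real.exp (c * y ^ 2) := by
    rw [← Real.exp_nat_mul, ← Real.exp_add]; congr 1; push_cast; ring
  have h3 := Real.exp_pos (c * x ^ 2)
  have h4 := Real.exp_pos (c * y ^ 2)
  refine le_of_sq_le_sq ?_ (by positivity)
  rw [h2]
  nlinarith [sq_nonneg (Real.exp (c * x ^ 2) - Real.exp (c * y ^ 2))]

/-- Jensen's inequality for `exp (c |·|)` and a time average of products. -/
theorem exp_mul_abs_average_le {T : ℕ} (hT : 0 < T) {c : ℝ} (hc : 0 ≤ c) (x y : Fin T → ℝ) :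
    Real.exp (c * |1 / (T : ℝ) * ∑ t, x t * y t|) ≤
      1 / (T : ℝ) * ∑ t, (Real.exp (c * x t ^ 2) + Real.exp (c * y t ^ 2)) / 2 := by
  have hT' : (0 : ℝ) < T := by exact_mod_cast hT
  have h1 : c * |1 / (T : ℝ) * ∑ t, x t * y t| ≤ ∑ t, (1 / (T : ℝ)) • (c * |x t * y t|) := by
    rw [abs_mul, abs_of_pos (by positivity : (0 : ℝ) < 1 / T)]
    calc c * (1 / (T : ℝ) * |∑ t, x t * y t|) ≤ c * (1 / (T : ℝ) * ∑ t, |x t * y t|) := by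
          gcongr; exact Finset.abs_sum_le_sum_abs _ _
      _ = _ := by
          simp only [Finset.mul_sum, smul_eq_mul]
          exact Finset.sum_congr rfl fun t _ => by ring
  refine (Real.exp_le_exp.2 h1).trans ?_
  refine (convexOn_exp.map_sum_le (fun _ _ => by positivity) (by simp [hT'.ne'])
    (fun _ _ => Set.mem_univ _)).trans ?_
  rw [Finset.mul_sum]
  refine Finset.sum_le_sum fun t _ => ?_
  rw [smul_eq_mul]
  gcongr
  exact exp_mul_abs_mul_le hc

/-- Convexity of `exp` moves the time average outside and AM-GM separates the factors of each
product, so the bound is free of `T` and of the dependence between periods. -/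
theorem integrable_exp_average [IsFiniteMeasure μ] {T : ℕ} (hT : 0 < T) (hC : 0 < C) (hK : 0 < K)
    {X Y : Fin T → Ω → ℝ} (hX : ∀ t, Measurable (X t)) (hY : ∀ t, Measurable (Y t))
    (hXt : ∀ t, SubgaussianTail μ (X t) C K) (hYt : ∀ t, SubgaussianTail μ (Y t) C K) :
    Integrable (fun ω => Real.exp (C / 4 * |1 / (T : ℝ) * ∑ t, X t ω * Y t ω|)) μ ∧
      ∫ ω, Real.exp (C / 4 * |1 / (T : ℝ) * ∑ t, X t ω * Y t ω|) ∂μ ≤ expSqBound C K := by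
  have hT' : (0 : ℝ) < T := by exact_mod_cast hT
  have hint : ∀ t, Integrable
      (fun ω => (Real.exp (C / 4 * X t ω ^ 2) + Real.exp (C / 4 * Y t ω ^ 2)) / 2) μ := fun t =>
    (((hXt t).integrable_exp_sq hC hK (hX t)).add
      ((hYt t).integrable_exp_sq hC hK (hY t))).div_const 2
  have hint' := (integrable_finsetSum Finset.univ fun t _ => hint t).const_mul (1 / (T : ℝ))
  have hle : ∀ ω, Real.exp (C / 4 * |1 / (T : ℝ) * ∑ t, X t ω * Y t ω|) ≤ _ := fun ω =>
    exp_mul_abs_average_le hT (by positivity : 0 ≤ C / 4) (fun t => X t ω) (fun t => Y t ω)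
  have hI : Integrable (fun ω => Real.exp (C / 4 * |1 / (T : ℝ) * ∑ t, X t ω * Y t ω|)) μ := by
    refine hint'.mono' (Measurable.aestronglyMeasurable (by fun_prop)) (ae_of_all _ fun ω => ?_)
    rw [Real.norm_of_nonneg (Real.exp_pos _).le]
    exact hle ω
  refine ⟨hI, (integral_mono hI hint' hle).trans ?_⟩
  rw [integral_const_mul, integral_finsetSum _ fun t _ => hint t]
  calc 1 / (T : ℝ) * ∑ t, ∫ ω, (Real.exp (C / 4 * X t ω ^ 2) + Real.exp (C / 4 * Y t ω ^ 2)) / 2 ∂μ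
      ≤ 1 / (T : ℝ) * ∑ _t : Fin T, expSqBound C K := by
        gcongr with t
        rw [integral_div, integral_add ((hXt t).integrable_exp_sq hC hK (hX t))
          ((hYt t).integrable_exp_sq hC hK (hY t))]
        linarith [(hXt t).integral_exp_sq_le hC hK (hX t), (hYt t).integral_exp_sq_le hC hK (hY t)]
    _ = expSqBound C K := by simp; field_simp

theorem exp_le_one_add_add_sq_mul_exp_abs (x : ℝ) :
    Real.exp x ≤ 1 + x + x ^ 2 * Real.exp |x| := by
  have h := Complex.norm_exp_sub_sum_le_norm_mul_exp (x : ℂ) 2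
  have h' : Complex.exp x - ∑ m ∈ Finset.range 2, (x : ℂ) ^ m / m.factorial
      = ((Real.exp x - (1 + x) : ℝ) : ℂ) := by
    simp [Finset.sum_range_succ]
  rw [h', Complex.norm_real, Complex.norm_real, Real.norm_eq_abs, Real.norm_eq_abs, sq_abs] at h
  linarith [(abs_le.1 h).2]

/-- A sub-exponential variable, centred, has a sub-Gaussian moment generating function near `0`. -/
theorem mgf_sub_integral_le [IsProbabilityMeasure μ] {c D θ : ℝ} (hc : 0 < c) (hV : Measurable V)
    (hint : Integrable (fun ω => Real.exp (c * |V ω|)) μ)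
    (hD : ∫ ω, Real.exp (c * |V ω|) ∂μ ≤ D) (hθ : |θ| ≤ c / 2) :
    Integrable V μ ∧ Integrable (fun ω => Real.exp (θ * (V ω - ∫ ω', V ω' ∂μ))) μ ∧
      mgf (fun ω => V ω - ∫ ω', V ω' ∂μ) μ θ ≤ Real.exp (8 / c ^ 2 * D * Real.exp D * θ ^ 2) := by
  have hVabs : ∀ ω, |V ω| ≤ 1 / c * Real.exp (c * |V ω|) := fun ω => by
    have := Real.add_one_le_exp (c * |V ω|)
    rw [one_div, inv_mul_eq_div, le_div_iff₀ hc]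
    linarith
  have hVint : Integrable V μ :=
    (hint.const_mul (1 / c)).mono' hV.aestronglyMeasurable (ae_of_all _ hVabs)
  set m := ∫ ω', V ω' ∂μ with hm
  have hm_le : c * |m| ≤ D := by
    have h1 : |m| ≤ ∫ ω, |V ω| ∂μ := abs_integral_le_integral_abs
    have h2 : ∫ ω, |V ω| ∂μ ≤ ∫ ω, 1 / c * Real.exp (c * |V ω|) ∂μ :=
      integral_mono hVint.abs (hint.const_mul _) hVabs
    rw [integral_const_mul] at h2
    have h3 : |m| ≤ 1 / c * D := h1.trans (h2.trans (by gcongr))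
    calc c * |m| ≤ c * (1 / c * D) := by gcongr
      _ = D := by field_simp
  have hD0 : 0 ≤ D := le_trans (integral_nonneg fun _ => (Real.exp_pos _).le) hD
  have hexpU : ∀ ω, Real.exp (c * |V ω - m|) ≤ Real.exp D * Real.exp (c * |V ω|) := fun ω => by
    rw [← Real.exp_add]
    refine Real.exp_le_exp.2 ?_
    have := abs_sub (V ω) m
    nlinarith
  have hpt : ∀ ω, Real.exp (θ * (V ω - m)) ≤
      -- The available exponent `c` is split in halves: one bounds `exp |θ (V - m)|`, the other
      -- absorbs the factor `(V - m)²`. The linear term vanishes on integration.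
      1 + θ * (V ω - m) + 8 / c ^ 2 * θ ^ 2 * (Real.exp D * Real.exp (c * |V ω|)) := fun ω => by
    refine (exp_le_one_add_add_sq_mul_exp_abs _).trans (add_le_add_right ?_ _)
    have h1 : |θ * (V ω - m)| ≤ c / 2 * |V ω - m| := by rw [abs_mul]; gcongr
    have h2 : (V ω - m) ^ 2 ≤ 8 / c ^ 2 * Real.exp (c / 2 * |V ω - m|) := by
      have h3 := Real.quadratic_le_exp_of_nonneg (by positivity : 0 ≤ c / 2 * |V ω - m|)
      have h4 : 0 ≤ c / 2 * |V ω - m| := by positivity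
      rw [div_mul_eq_mul_div, le_div_iff₀ (by positivity), ← sq_abs (V ω - m)]
      nlinarith
    calc (θ * (V ω - m)) ^ 2 * Real.exp |θ * (V ω - m)|
        ≤ θ ^ 2 * (8 / c ^ 2 * Real.exp (c / 2 * |V ω - m|)) * Real.exp (c / 2 * |V ω - m|) := by
          rw [mul_pow]; gcongr
      _ = 8 / c ^ 2 * θ ^ 2 * Real.exp (c * |V ω - m|) := by
          have : Real.exp (c * |V ω - m|)
              = Real.exp (c / 2 * |V ω - m|) * Real.exp (c / 2 * |V ω - m|) := by
            rw [← Real.exp_add]; congr 1; ring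
          rw [this]; ring
      _ ≤ _ := by gcongr; exact hexpU ω
  have hUint : Integrable (fun ω => V ω - m) μ := hVint.sub (integrable_const _)
  have hint1 : Integrable (fun ω => 1 + θ * (V ω - m)) μ :=
    (integrable_const _).add (hUint.const_mul θ)
  have hint2 := (hint.const_mul (Real.exp D)).const_mul (8 / c ^ 2 * θ ^ 2)
  have hexp : Integrable (fun ω => Real.exp (θ * (V ω - m))) μ := by
    refine (hint1.add hint2).mono' (Measurable.aestronglyMeasurable (by fun_prop))
      (ae_of_all _ fun ω => ?_)
    rw [Real.norm_of_nonneg (Real.exp_pos _).le]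
    exact hpt ω
  refine ⟨hVint, hexp, ?_⟩
  calc mgf (fun ω => V ω - m) μ θ
      ≤ ∫ ω, (1 + θ * (V ω - m) + 8 / c ^ 2 * θ ^ 2 * (Real.exp D * Real.exp (c * |V ω|))) ∂μ :=
        integral_mono hexp (hint1.add hint2) hpt
    _ = 1 + 8 / c ^ 2 * θ ^ 2 * (Real.exp D * ∫ ω, Real.exp (c * |V ω|) ∂μ) := by
        rw [integral_add hint1 hint2, integral_add (integrable_const _) (hUint.const_mul θ),
          integral_const_mul, integral_const_mul, integral_const_mul,
          integral_sub hVint (integrable_const _)]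
        simp [← hm]
    _ ≤ 1 + 8 / c ^ 2 * θ ^ 2 * (Real.exp D * D) := by gcongr
    _ ≤ _ := by
        have := Real.add_one_le_exp (8 / c ^ 2 * D * Real.exp D * θ ^ 2)
        linarith

/-- One-sided Bernstein inequality for independent uniformly sub-exponential variables. -/
theorem measure_sum_sub_integral_ge_le [IsProbabilityMeasure μ] {N : ℕ} {V : Fin N → Ω → ℝ}
    {c D u κ : ℝ} (hc : 0 < c) (hV : ∀ i, Measurable (V i)) (hind : iIndepFun V μ)
    (hint : ∀ i, Integrable (fun ω => Real.exp (c * |V i ω|)) μ)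
    (hD : ∀ i, ∫ ω, Real.exp (c * |V i ω|) ∂μ ≤ D) (hκ0 : 0 < κ)
    (hκ : 8 / c ^ 2 * D * Real.exp D ≤ κ) (hu : |u| ≤ c * κ) (hu0 : 0 ≤ u) (s : ℝ) (hs : |s| = 1) :
    μ.real {ω | N * u ≤ s * ∑ i, (V i ω - ∫ ω', V i ω' ∂μ)} ≤ Real.exp (-(N * u ^ 2 / (4 * κ))) := by
  -- The minimizer of `-θ u + κ θ²`; the condition `u ≤ c κ` keeps it in the range `θ ≤ c / 2` where
  -- the moment generating function is controlled.
  set θ := u / (2 * κ) with hθ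
  have hθ0 : 0 ≤ θ := by positivity
  have hs2 : s ^ 2 = 1 := by rw [← sq_abs, hs, one_pow]
  have hθs : |θ * s| ≤ c / 2 := by
    rw [abs_mul, hs, mul_one, abs_of_nonneg hθ0, hθ, div_le_iff₀ (by positivity)]
    rw [abs_of_nonneg hu0] at hu
    linarith
  have hkey := fun i => mgf_sub_integral_le hc (hV i) (hint i) (hD i) hθs
  have hUm : ∀ i, Measurable fun ω => V i ω - ∫ ω', V i ω' ∂μ := fun i => (hV i).sub_const _
  have hUind : iIndepFun (fun i ω => V i ω - ∫ ω', V i ω' ∂μ) μ :=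
    hind.comp (fun i x => x - ∫ ω', V i ω' ∂μ) fun i => by fun_prop
  have hprod : mgf (fun ω => s * ∑ i, (V i ω - ∫ ω', V i ω' ∂μ)) μ θ ≤
      Real.exp (N * (κ * θ ^ 2)) := by
    rw [mgf_const_mul, mul_comm s θ]
    have h1 := hUind.mgf_sum (t := θ * s) hUm Finset.univ
    have h2 : (∑ i, fun ω => V i ω - ∫ ω', V i ω' ∂μ)
        = fun ω => ∑ i, (V i ω - ∫ ω', V i ω' ∂μ) := by
      ext ω; simp
    rw [h2] at h1
    rw [h1]
    calc ∏ i, mgf (fun ω => V i ω - ∫ ω', V i ω' ∂μ) μ (θ * s)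
        ≤ ∏ _i : Fin N, Real.exp (κ * θ ^ 2) := by
          refine Finset.prod_le_prod (fun i _ => mgf_nonneg) fun i _ => (hkey i).2.2.trans ?_
          rw [mul_pow, hs2, mul_one]
          gcongr
      _ = _ := by rw [Finset.prod_const, Finset.card_univ, Fintype.card_fin, Real.exp_nat_mul]
  have hintS : Integrable (fun ω => Real.exp (θ * (s * ∑ i, (V i ω - ∫ ω', V i ω' ∂μ)))) μ := by
    have h1 := hUind.integrable_exp_mul_sum (t := θ * s) hUm (s := Finset.univ)
      fun i _ => (hkey i).2.1
    refine h1.congr (ae_of_all _ fun ω => ?_)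
    simp [mul_assoc]
  refine (measure_ge_le_exp_mul_mgf (N * u) hθ0 hintS).trans ?_
  calc Real.exp (-θ * (N * u)) * mgf (fun ω => s * ∑ i, (V i ω - ∫ ω', V i ω' ∂μ)) μ θ
      ≤ Real.exp (-θ * (N * u)) * Real.exp (N * (κ * θ ^ 2)) := by gcongr
    _ = Real.exp (-(N * u ^ 2 / (4 * κ))) := by
        rw [← Real.exp_add, hθ]; congr 1; field_simp; ring

/-- Bernstein inequality for independent uniformly sub-exponential variables. -/
theorem measure_abs_sum_sub_integral_gt_le [IsProbabilityMeasure μ] {N : ℕ} {V : Fin N → Ω → ℝ}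
    {c D u κ : ℝ} (hc : 0 < c) (hV : ∀ i, Measurable (V i)) (hind : iIndepFun V μ)
    (hint : ∀ i, Integrable (fun ω => Real.exp (c * |V i ω|)) μ)
    (hD : ∀ i, ∫ ω, Real.exp (c * |V i ω|) ∂μ ≤ D) (hκ0 : 0 < κ)
    (hκ : 8 / c ^ 2 * D * Real.exp D ≤ κ) (hu : u ≤ c * κ) (hu0 : 0 ≤ u) :
    μ.real {ω | N * u < |∑ i, (V i ω - ∫ ω', V i ω' ∂μ)|} ≤
      2 * Real.exp (-(N * u ^ 2 / (4 * κ))) := by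
  have hu' : |u| ≤ c * κ := by rwa [abs_of_nonneg hu0]
  have h1 := measure_sum_sub_integral_ge_le hc hV hind hint hD hκ0 hκ hu' hu0 1 (by simp)
  have h2 := measure_sum_sub_integral_ge_le hc hV hind hint hD hκ0 hκ hu' hu0 (-1) (by simp)
  have hsub : {ω | N * u < |∑ i, (V i ω - ∫ ω', V i ω' ∂μ)|} ⊆
      {ω | N * u ≤ 1 * ∑ i, (V i ω - ∫ ω', V i ω' ∂μ)} ∪
        {ω | N * u ≤ -1 * ∑ i, (V i ω - ∫ ω', V i ω' ∂μ)} := by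
    intro ω hω
    simp only [Set.mem_ofPred_eq, Set.mem_union] at hω ⊢
    rcases lt_abs.1 hω with h | h
    · left; linarith
    · right; linarith
  calc _ ≤ _ := measureReal_mono hsub
    _ ≤ _ := measureReal_union_le _ _
    _ ≤ _ := by linarith

end Tails

theorem SubgaussianTail.integrable_mul {Ω : Type*} [MeasurableSpace Ω] {μ : Measure Ω}
    [IsFiniteMeasure μ] {X Y : Ω → ℝ} {C K : ℝ} (hC : 0 < C) (hK : 0 < K)
    (hXt : SubgaussianTail μ X C K) (hYt : SubgaussianTail μ Y C K)
    (hX : Measurable X) (hY : Measurable Y) : Integrable (fun ω => X ω * Y ω) μ := by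
  refine ((((hXt.integrable_exp_sq hC hK hX).add
    (hYt.integrable_exp_sq hC hK hY)).div_const 2).const_mul (4 / C)).mono'
    (hX.mul hY).aestronglyMeasurable (ae_of_all _ fun ω => ?_)
  have h1 := exp_mul_abs_mul_le (x := X ω) (y := Y ω) (by positivity : 0 ≤ C / 4)
  have h2 := Real.add_one_le_exp (C / 4 * |X ω * Y ω|)
  rw [Real.norm_eq_abs, div_mul_eq_mul_div, le_div_iff₀ hC]
  simp only [Pi.add_apply]
  linarith

/-! ### Uniform concentration of the pooled second moments. -/

namespace DynamicPanel

variable {Ω : Type*} [mΩ : MeasurableSpace Ω] (P : DynamicPanel Ω) (μ : Measure Ω)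

theorem measurable_block (i : Fin P.N) : Measurable (P.block i) := by
  refine Measurable.prodMk ?_ (Measurable.prodMk ?_ ?_)
  · exact measurable_pi_lambda _ fun l => P.measurable_initial i l
  · exact measurable_pi_lambda _ fun t => measurable_pi_lambda _ fun k => P.measurable_x i t k
  · exact measurable_pi_lambda _ fun t => P.measurable_ε i t

theorem measurable_comap_block_initial (i : Fin P.N) (l : Fin P.L) :
    Measurable[MeasurableSpace.comap (P.block i) inferInstance] (P.y i (-(l : ℤ))) := by
  have h : Measurable fun b : (Fin P.L → ℝ) × (Fin P.T → Fin P.px → ℝ) × (Fin P.T → ℝ) =>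
      b.1 l := by fun_prop
  exact h.comp (comap_measurable (P.block i))

theorem measurable_comap_block_x (i : Fin P.N) (t : Fin P.T) (k : Fin P.px) :
    Measurable[MeasurableSpace.comap (P.block i) inferInstance] (P.x i t k) := by
  have h : Measurable fun b : (Fin P.L → ℝ) × (Fin P.T → Fin P.px → ℝ) × (Fin P.T → ℝ) =>
      b.2.1 t k := by fun_prop
  exact h.comp (comap_measurable (P.block i))

theorem measurable_comap_block_ε (i : Fin P.N) (t : Fin P.T) :
    Measurable[MeasurableSpace.comap (P.block i) inferInstance] (P.ε i t) := by
  have h : Measurable fun b : (Fin P.L → ℝ) × (Fin P.T → Fin P.px → ℝ) × (Fin P.T → ℝ) =>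
      b.2.2 t := by fun_prop
  exact h.comp (comap_measurable (P.block i))

/-- The outcomes of individual `i` are functions of the `i`th block. -/
theorem measurable_comap_block_y (i : Fin P.N) (n : ℕ) :
    ∀ s : ℤ, 1 - (P.L : ℤ) ≤ s → s ≤ n → s ≤ P.T →
      Measurable[MeasurableSpace.comap (P.block i) inferInstance] (P.y i s) := by
  -- Induction on an upper bound for the period, since the model equation calls on all of the `L`
  -- preceding outcomes. The restriction `s ≤ T` matters: later outcomes are not tied to the block.
  induction n with
  | zero =>
    intro s hs1 hs2 _
    have h := P.measurable_comap_block_initial i ⟨(-s).toNat, by omega⟩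
    have hs : -(((-s).toNat : ℕ) : ℤ) = s := by omega
    rwa [show -(((⟨(-s).toNat, by omega⟩ : Fin P.L) : ℕ) : ℤ) = s from hs] at h
  | succ n ih =>
    intro s hs1 hs2 hs3
    rcases lt_or_eq_of_le hs2 with h | h
    · exact ih s hs1 (by push_cast at h; omega) hs3
    · have hn : n < P.T := by push_cast at h; omega
      have hfun : P.y i s = fun ω =>
          ∑ l : Fin P.L, P.α (Sum.inl l) * P.y i ((n : ℤ) + 1 - ((l : ℤ) + 1)) ω
            + ∑ k : Fin P.px, P.α (Sum.inr k) * P.x i ⟨n, hn⟩ k ω + P.η i + P.ε i ⟨n, hn⟩ ω := by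
        funext ω
        rw [h]
        exact P.model i ⟨n, hn⟩ ω
      rw [hfun]
      have h1 : ∀ l : Fin P.L, Measurable[MeasurableSpace.comap (P.block i) inferInstance]
          (P.y i ((n : ℤ) + 1 - ((l : ℤ) + 1))) := fun l =>
        ih _ (by have := l.2; omega) (by omega) (by omega)
      have h2 := P.measurable_comap_block_x i ⟨n, hn⟩
      have h3 := P.measurable_comap_block_ε i ⟨n, hn⟩
      exact (((Finset.measurable_fun_sum _ fun l _ => (h1 l).const_mul _).add
        (Finset.measurable_fun_sum _ fun k _ => (h2 k).const_mul _)).add_const _).add h3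

theorem measurable_comap_block_z (i : Fin P.N) (t : Fin P.T) (k : P.Idx) :
    Measurable[MeasurableSpace.comap (P.block i) inferInstance] (P.z i t k) := by
  rcases k with l | k
  · refine P.measurable_comap_block_y i t _ ?_ ?_ ?_
    · have := l.2; omega
    · omega
    · have := t.2; omega
  · exact P.measurable_comap_block_x i t k

theorem measurable_comap_block_resid (j : P.Idx) (δ : P.Others j → ℝ) (i : Fin P.N)
    (t : Fin P.T) :
    Measurable[MeasurableSpace.comap (P.block i) inferInstance] (P.resid j δ i t) :=
  (P.measurable_comap_block_z i t j).sub
    (Finset.measurable_fun_sum _ fun k _ => (P.measurable_comap_block_z i t k.1).mul_const _)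

/-- The regressors `z_k` together with the nodewise regression errors `ζ_j`. -/
noncomputable def nodewise (i : Fin P.N) (t : Fin P.T) : P.Idx ⊕ P.Idx → Ω → ℝ
  | Sum.inl k => P.z i t k
  | Sum.inr j => P.zeta μ j i t

theorem measurable_comap_block_nodewise (i : Fin P.N) (t : Fin P.T) (a : P.Idx ⊕ P.Idx) :
    Measurable[MeasurableSpace.comap (P.block i) inferInstance] (P.nodewise μ i t a) := by
  rcases a with k | j
  · exact P.measurable_comap_block_z i t k
  · exact P.measurable_comap_block_resid j _ i t

theorem measurable_nodewise (i : Fin P.N) (t : Fin P.T) (a : P.Idx ⊕ P.Idx) :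
    Measurable (P.nodewise μ i t a) :=
  (P.measurable_comap_block_nodewise μ i t a).mono (P.measurable_block i).comap_le le_rfl

/-- The pooled sample mean of `X Y`. -/
noncomputable def sampleMoment (X Y : Fin P.N → Fin P.T → Ω → ℝ) (ω : Ω) : ℝ :=
  1 / ((P.N : ℝ) * P.T) * ∑ i, ∑ t, X i t ω * Y i t ω

/-- The pooled expectation of `X Y`. -/
noncomputable def popMoment (X Y : Fin P.N → Fin P.T → Ω → ℝ) : ℝ :=
  1 / ((P.N : ℝ) * P.T) * ∑ i, ∑ t, ∫ ω, X i t ω * Y i t ω ∂μ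

/-- Uniform sub-Gaussian tails of regressors and nodewise regression errors. -/
def NodewiseTails (C K : ℝ) : Prop := ∀ i t a, SubgaussianTail μ (P.nodewise μ i t a) C K

/-- The exponential moment rate of products of variables with sub-Gaussian tails. -/
noncomputable def _root_.bernsteinConst (C K : ℝ) : ℝ :=
  8 / (C / 4) ^ 2 * expSqBound C K * Real.exp (expSqBound C K) + 1

theorem _root_.bernsteinConst_pos {C K : ℝ} (hK : 0 < K) : 0 < bernsteinConst C K := by
  have := expSqBound_nonneg (C := C) hK
  unfold bernsteinConst
  positivity

variable {P μ}

theorem NodewiseTails.integrable_mul [IsFiniteMeasure μ] {C K : ℝ} (hC : 0 < C) (hK : 0 < K)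
    (h : P.NodewiseTails μ C K) (a b : P.Idx ⊕ P.Idx) (i : Fin P.N) (t : Fin P.T) :
    Integrable (fun ω => P.nodewise μ i t a ω * P.nodewise μ i t b ω) μ :=
  (h i t a).integrable_mul hC hK (h i t b) (P.measurable_nodewise μ i t a)
    (P.measurable_nodewise μ i t b)

/-- The time averages of the products are functions of the independent blocks, so Bernstein's
inequality applies to them with `N` as the sample size. -/
theorem NodewiseTails.measure_moment_deviation_le [IsProbabilityMeasure μ] {C K u : ℝ} (hC : 0 < C)
    (hK : 0 < K) (h : P.NodewiseTails μ C K) (hP : P.PanelAssumption μ) (hu0 : 0 ≤ u)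
    (hu : u ≤ C / 4 * bernsteinConst C K) (a b : P.Idx ⊕ P.Idx) :
    μ.real {ω | u < |P.sampleMoment (fun i t => P.nodewise μ i t a)
        (fun i t => P.nodewise μ i t b) ω - P.popMoment μ (fun i t => P.nodewise μ i t a)
        (fun i t => P.nodewise μ i t b)|} ≤
      2 * Real.exp (-(P.N * u ^ 2 / (4 * bernsteinConst C K))) := by
  have hN : (0 : ℝ) < P.N := by exact_mod_cast P.N_pos
  have hT : (0 : ℝ) < P.T := by exact_mod_cast P.T_pos
  set V : Fin P.N → Ω → ℝ := fun i ω =>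
    1 / (P.T : ℝ) * ∑ t, P.nodewise μ i t a ω * P.nodewise μ i t b ω with hV
  have hVb : ∀ i, Measurable[MeasurableSpace.comap (P.block i) inferInstance] (V i) := fun i =>
    (Finset.measurable_fun_sum _ fun t _ => (P.measurable_comap_block_nodewise μ i t a).mul
      (P.measurable_comap_block_nodewise μ i t b)).const_mul _
  have hVm : ∀ i, Measurable (V i) := fun i => (hVb i).mono (P.measurable_block i).comap_le le_rfl
  have hind : iIndepFun V μ :=
    (iIndepFun_iff_iIndep _ _ _).2
      (iIndep_of_iIndep_of_le hP.indep.iIndep fun i => (hVb i).comap_le)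
  have hexp := fun i => integrable_exp_average (μ := μ) P.T_pos hC hK
    (P.measurable_nodewise μ i · a) (P.measurable_nodewise μ i · b) (h i · a) (h i · b)
  have hB := measure_abs_sum_sub_integral_gt_le (u := u) (κ := bernsteinConst C K)
    (by positivity : 0 < C / 4) hVm hind
    (fun i => (hexp i).1) (fun i => (hexp i).2) (bernsteinConst_pos hK)
    (by unfold bernsteinConst; linarith) hu hu0
  refine le_trans (measureReal_mono fun ω hω => ?_) hB
  simp only [Set.mem_ofPred_eq] at hω ⊢
  have hEV : ∀ i, ∫ ω', V i ω' ∂μ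
      = 1 / (P.T : ℝ) * ∑ t, ∫ ω', P.nodewise μ i t a ω' * P.nodewise μ i t b ω' ∂μ := fun i => by
    rw [hV]
    simp only
    rw [integral_const_mul, integral_finsetSum _ fun t _ => h.integrable_mul hC hK a b i t]
  have hsum : ∑ i, (V i ω - ∫ ω', V i ω' ∂μ) = P.N *
      (P.sampleMoment (fun i t => P.nodewise μ i t a) (fun i t => P.nodewise μ i t b) ω
        - P.popMoment μ (fun i t => P.nodewise μ i t a) (fun i t => P.nodewise μ i t b)) := by
    rw [Finset.sum_sub_distrib, Finset.sum_congr rfl fun i _ => hEV i]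
    simp only [hV, sampleMoment, popMoment, ← Finset.mul_sum]
    field_simp
  rw [hsum, abs_mul, abs_of_pos hN]
  gcongr

/-- All moment deviations are at most `u`. -/
def MomentsClose (P : DynamicPanel Ω) (μ : Measure Ω) (u : ℝ) (ω : Ω) : Prop :=
  ∀ a b, |P.sampleMoment (fun i t => P.nodewise μ i t a) (fun i t => P.nodewise μ i t b) ω
    - P.popMoment μ (fun i t => P.nodewise μ i t a) (fun i t => P.nodewise μ i t b)| ≤ u

theorem NodewiseTails.measure_not_momentsClose_le [IsProbabilityMeasure μ] {C K u : ℝ} (hC : 0 < C)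
    (hK : 0 < K) (h : P.NodewiseTails μ C K) (hP : P.PanelAssumption μ) (hu0 : 0 ≤ u)
    (hu : u ≤ C / 4 * bernsteinConst C K) :
    μ {ω | ¬ P.MomentsClose μ u ω} ≤ ENNReal.ofReal
      ((2 * P.p) ^ 2 * (2 * Real.exp (-(P.N * u ^ 2 / (4 * bernsteinConst C K))))) := by
  have hset : {ω | ¬ P.MomentsClose μ u ω} = ⋃ q : (P.Idx ⊕ P.Idx) × (P.Idx ⊕ P.Idx),
      {ω | u < |P.sampleMoment (fun i t => P.nodewise μ i t q.1)
        (fun i t => P.nodewise μ i t q.2) ω - P.popMoment μ (fun i t => P.nodewise μ i t q.1)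
        (fun i t => P.nodewise μ i t q.2)|} := by
    ext ω
    simp only [MomentsClose, Set.mem_ofPred_eq, Set.mem_iUnion, Prod.exists, not_forall, not_le]
  rw [hset]
  refine (measure_iUnion_fintype_le _ _).trans ?_
  calc _ ≤ ∑ _q : (P.Idx ⊕ P.Idx) × (P.Idx ⊕ P.Idx), ENNReal.ofReal
          (2 * Real.exp (-(P.N * u ^ 2 / (4 * bernsteinConst C K)))) := by
        refine Finset.sum_le_sum fun q _ => ?_
        rw [← ofReal_measureReal]
        exact ENNReal.ofReal_le_ofReal (h.measure_moment_deviation_le hC hK hP hu0 hu q.1 q.2)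
    _ = _ := by
        rw [Finset.sum_const, nsmul_eq_mul, ← ENNReal.ofReal_natCast,
          ← ENNReal.ofReal_mul (Nat.cast_nonneg _)]
        congr 2
        simp [p, Finset.card_univ]
        ring

end DynamicPanel

/-- With high probability all moments are within `A √(log p / N)` of their expectations. -/
theorem exists_measure_not_momentsClose_le {C K : ℝ} (hC : 0 < C) (hK : 0 < K) {ε : ℝ}
    (hε : 0 < ε) : ∃ A u₀ : ℝ, 0 < A ∧ 0 < u₀ ∧
      ∀ {Ω : Type*} [MeasurableSpace Ω] (μ : Measure Ω) [IsProbabilityMeasure μ]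
        (P : DynamicPanel Ω), 2 ≤ P.p → P.PanelAssumption μ → P.NodewiseTails μ C K →
        A * Real.sqrt (Real.log P.p / P.N) ≤ u₀ →
        μ {ω | ¬ P.MomentsClose μ (A * Real.sqrt (Real.log P.p / P.N)) ω} ≤ ENNReal.ofReal ε := by
  have hκ := bernsteinConst_pos (C := C) hK
  set κ := bernsteinConst C K with hκd
  have hl2 : 0 < Real.log 2 := Real.log_pos (by norm_num)
  -- With this `A` the exponent is `(2 + q) log p`. The part `2 log p` cancels the `p²` of the union
  -- bound, and `p ≥ 2` turns `p^(-q)` into at most `ε / 8`.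
  set q := |Real.log (8 / ε)| / Real.log 2 with hq
  have hq0 : 0 ≤ q := by positivity
  refine ⟨Real.sqrt (4 * κ * (2 + q)), C / 4 * κ, by positivity, by positivity, ?_⟩
  intro Ω _ μ _ P hp hP hT hu
  refine (hT.measure_not_momentsClose_le hC hK hP (by positivity) hu).trans
    (ENNReal.ofReal_le_ofReal ?_)
  have hN : (0 : ℝ) < P.N := by exact_mod_cast P.N_pos
  have hp' : (2 : ℝ) ≤ P.p := by exact_mod_cast hp
  have hlp : Real.log 2 ≤ Real.log P.p := Real.log_le_log (by norm_num) hp'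
  have hexp : P.N * (Real.sqrt (4 * κ * (2 + q)) * Real.sqrt (Real.log P.p / P.N)) ^ 2 / (4 * κ)
      = (2 + q) * Real.log P.p := by
    rw [mul_pow, Real.sq_sqrt (by positivity), Real.sq_sqrt (div_nonneg (by linarith) hN.le)]
    field_simp
  rw [← hκd, hexp]
  have hpe : (P.p : ℝ) ^ 2 = Real.exp (2 * Real.log P.p) := by
    rw [mul_comm, Real.exp_mul, Real.exp_log (by linarith)]; norm_cast
  calc (2 * (P.p : ℝ)) ^ 2 * (2 * Real.exp (-((2 + q) * Real.log P.p)))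
      = 8 * Real.exp (-(q * Real.log P.p)) := by
        rw [mul_pow, hpe]
        have : Real.exp (-(q * Real.log P.p)) = Real.exp (2 * Real.log P.p) *
            Real.exp (-((2 + q) * Real.log P.p)) := by rw [← Real.exp_add]; congr 1; ring
        rw [this]; ring
    _ ≤ 8 * Real.exp (-Real.log (8 / ε)) := by
        have h1 : Real.log (8 / ε) ≤ q * Real.log P.p := by
          calc Real.log (8 / ε) ≤ |Real.log (8 / ε)| := le_abs_self _
            _ = q * Real.log 2 := by rw [hq]; field_simp
            _ ≤ _ := by gcongr
        gcongr
    _ = ε := by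
        rw [Real.exp_neg, Real.exp_log (by positivity)]; field_simp

/-! ### Extreme eigenvalues and quadratic forms. -/

section Spectral

open scoped Matrix

variable {ι : Type*} [Fintype ι] [DecidableEq ι] {A : Matrix ι ι ℝ} {c : ℝ}

/-- Subtracting `c` times the identity shifts the spectrum by `-c`, so the difference is positive
semidefinite. Finiteness of the spectrum makes its infimum a genuine lower bound. -/
theorem Matrix.IsHermitian.mul_dotProduct_le_of_le_mineval (hA : A.IsHermitian)
    (hc : c ≤ mineval A) (v : ι → ℝ) : c * (v ⬝ᵥ v) ≤ v ⬝ᵥ A *ᵥ v := by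
  have hB : (-(algebraMap ℝ (Matrix ι ι ℝ) c) + A).IsHermitian := by
    refine Matrix.IsHermitian.add (Matrix.IsHermitian.neg ?_) hA
    rw [Matrix.algebraMap_eq_diagonal]
    exact Matrix.isHermitian_diagonal _
  have hpos := hB.posSemidef_iff_eigenvalues_nonneg.2 fun i => by
    have h1 := hB.eigenvalues_mem_spectrum_real i
    rw [← spectrum.add_mem_iff] at h1
    have h2 := csInf_le (Matrix.finite_spectrum A).bddBelow h1
    simp only [Pi.zero_apply]
    unfold mineval at hc
    linarith
  have h := hpos.dotProduct_mulVec_nonneg v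
  rw [star_trivial, Matrix.add_mulVec, Matrix.neg_mulVec, dotProduct_add, dotProduct_neg,
    Algebra.algebraMap_eq_smul_one, Matrix.smul_mulVec, Matrix.one_mulVec, dotProduct_smul,
    smul_eq_mul] at h
  linarith

theorem Matrix.IsHermitian.dotProduct_le_of_maxeval_le (hA : A.IsHermitian)
    (hc : maxeval A ≤ c) (v : ι → ℝ) : v ⬝ᵥ A *ᵥ v ≤ c * (v ⬝ᵥ v) := by
  have h : -c ≤ mineval (-A) := by
    unfold mineval
    rw [← spectrum.neg_eq, Real.sInf_def, neg_neg]
    exact neg_le_neg hc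
  have := hA.neg.mul_dotProduct_le_of_le_mineval h v
  rw [Matrix.neg_mulVec, dotProduct_neg] at this
  linarith

/-- A uniform lower bound on the quadratic form makes the matrix positive definite, hence `Θ_Z` is a
true inverse and not the default value. -/
theorem Matrix.isUnit_det_of_mul_dotProduct_le (hA : A.IsHermitian) (hc0 : 0 < c)
    (hc : ∀ v, c * (v ⬝ᵥ v) ≤ v ⬝ᵥ A *ᵥ v) : IsUnit A.det := by
  have hpd : A.PosDef := Matrix.PosDef.of_dotProduct_mulVec_pos hA fun v hv => by
    rw [star_trivial]
    refine lt_of_lt_of_le (mul_pos hc0 ?_) (hc v)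
    refine lt_of_le_of_ne (Finset.sum_nonneg fun i _ => mul_self_nonneg _) fun h => hv ?_
    exact dotProduct_self_eq_zero.1 h.symm
  exact (Matrix.isUnit_iff_isUnit_det A).1 hpd.isUnit

end Spectral

/-! ### The population nodewise regression as a row of the inverse second moment matrix. -/

namespace DynamicPanel

open scoped Matrix

variable {Ω : Type*} [mΩ : MeasurableSpace Ω] {P : DynamicPanel Ω} {μ : Measure Ω}

theorem CRow_self (j : P.Idx) (δ : P.Others j → ℝ) : P.CRow j δ j = 1 := by simp [CRow]

theorem CRow_other (j : P.Idx) (δ : P.Others j → ℝ) (k : P.Others j) : P.CRow j δ k = -δ k := by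
  simp [CRow, k.2]

theorem sum_idx_eq (j : P.Idx) (f : P.Idx → ℝ) : ∑ k, f k = f j + ∑ k : P.Others j, f k := by
  rw [← Finset.add_sum_erase _ f (Finset.mem_univ j)]
  congr 1
  rw [← Finset.sum_subtype (Finset.univ.erase j) (by simp) f]

theorem eq_CRow {j : P.Idx} {v : P.Idx → ℝ} (hv : v j = 1) :
    v = P.CRow j fun k => -v k := by
  funext k
  by_cases h : k = j
  · subst h; rw [CRow_self, hv]
  · rw [CRow_other j _ ⟨k, h⟩]; simp

theorem resid_eq (j : P.Idx) (δ : P.Others j → ℝ) (i : Fin P.N) (t : Fin P.T) (ω : Ω) :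
    P.resid j δ i t ω = ∑ k, P.CRow j δ k * P.z i t k ω := by
  rw [sum_idx_eq j, CRow_self, resid, one_mul, sub_eq_add_neg, ← Finset.sum_neg_distrib]
  congr 1
  refine Finset.sum_congr rfl fun k _ => ?_
  rw [CRow_other]; ring

/-- The sample second moment matrix. -/
noncomputable def PsiHat (P : DynamicPanel Ω) (ω : Ω) : Matrix P.Idx P.Idx ℝ :=
  Matrix.of fun k l => P.sampleMoment (fun i t => P.z i t k) (fun i t => P.z i t l) ω

theorem _root_.mul_sum_sum_eq_dotProduct_mulVec {I J κ : Type*} [Fintype I] [Fintype J] [Fintype κ]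
    (q : ℝ) (v w : κ → ℝ) (f : I → J → κ → κ → ℝ) :
    q * ∑ i, ∑ t, ∑ k, ∑ l, v k * w l * f i t k l =
      v ⬝ᵥ (Matrix.of fun k l => q * ∑ i, ∑ t, f i t k l) *ᵥ w := by
  calc q * ∑ i, ∑ t, ∑ k, ∑ l, v k * w l * f i t k l
      = ∑ i, ∑ t, ∑ k, ∑ l, q * (v k * w l * f i t k l) := by simp only [Finset.mul_sum]
    _ = ∑ i, ∑ k, ∑ t, ∑ l, q * (v k * w l * f i t k l) :=
        Finset.sum_congr rfl fun i _ => Finset.sum_comm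
    _ = ∑ k, ∑ i, ∑ t, ∑ l, q * (v k * w l * f i t k l) := Finset.sum_comm
    _ = ∑ k, ∑ i, ∑ l, ∑ t, q * (v k * w l * f i t k l) :=
        Finset.sum_congr rfl fun k _ => Finset.sum_congr rfl fun i _ => Finset.sum_comm
    _ = ∑ k, ∑ l, ∑ i, ∑ t, q * (v k * w l * f i t k l) :=
        Finset.sum_congr rfl fun k _ => Finset.sum_comm
    _ = _ := by
        simp only [dotProduct, Matrix.mulVec, Matrix.of_apply, Finset.mul_sum, Finset.sum_mul]
        refine Finset.sum_congr rfl fun k _ => Finset.sum_congr rfl fun l _ =>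
          Finset.sum_congr rfl fun i _ => Finset.sum_congr rfl fun t _ => ?_
        ring

theorem _root_.sum_mul_mul_sum_mul {κ : Type*} [Fintype κ] (v w x : κ → ℝ) :
    (∑ k, v k * x k) * (∑ k, w k * x k) = ∑ k, ∑ l, v k * w l * (x k * x l) := by
  rw [Finset.sum_mul_sum]
  exact Finset.sum_congr rfl fun k _ => Finset.sum_congr rfl fun l _ => by ring

theorem sampleMoment_linear (v w : P.Idx → ℝ) (ω : Ω) :
    P.sampleMoment (fun i t ω => ∑ k, v k * P.z i t k ω) (fun i t ω => ∑ k, w k * P.z i t k ω) ω =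
      v ⬝ᵥ P.PsiHat ω *ᵥ w := by
  simp only [sampleMoment, sum_mul_mul_sum_mul]
  exact mul_sum_sum_eq_dotProduct_mulVec _ v w fun i t k l => P.z i t k ω * P.z i t l ω

theorem popMoment_linear (hz : ∀ i t k l, Integrable (fun ω => P.z i t k ω * P.z i t l ω) μ)
    (v w : P.Idx → ℝ) :
    P.popMoment μ (fun i t ω => ∑ k, v k * P.z i t k ω) (fun i t ω => ∑ k, w k * P.z i t k ω) =
      v ⬝ᵥ P.PsiZ μ *ᵥ w := by
  have h : ∀ i t, ∫ ω, (∑ k, v k * P.z i t k ω) * (∑ k, w k * P.z i t k ω) ∂μ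
      = ∑ k, ∑ l, v k * w l * ∫ ω, P.z i t k ω * P.z i t l ω ∂μ := fun i t => by
    simp_rw [sum_mul_mul_sum_mul v w fun k => P.z i t k _]
    rw [integral_finsetSum _ fun k _ => integrable_finsetSum _ fun l _ =>
      (hz i t k l).const_mul _]
    refine Finset.sum_congr rfl fun k _ => ?_
    rw [integral_finsetSum _ fun l _ => (hz i t k l).const_mul _]
    exact Finset.sum_congr rfl fun l _ => integral_const_mul _ _
  simp_rw [popMoment, h]
  exact mul_sum_sum_eq_dotProduct_mulVec _ v w fun i t k l => ∫ ω, P.z i t k ω * P.z i t l ω ∂μ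

theorem empRisk_eq (j : P.Idx) (δ : P.Others j → ℝ) (ω : Ω) :
    P.empRisk j ω δ = P.CRow j δ ⬝ᵥ P.PsiHat ω *ᵥ P.CRow j δ := by
  rw [← sampleMoment_linear]
  simp only [empRisk, sampleMoment, resid_eq, pow_two]

theorem popRisk_eq (hz : ∀ i t k l, Integrable (fun ω => P.z i t k ω * P.z i t l ω) μ)
    (j : P.Idx) (δ : P.Others j → ℝ) :
    P.popRisk μ j δ = P.CRow j δ ⬝ᵥ P.PsiZ μ *ᵥ P.CRow j δ := by
  rw [← popMoment_linear hz]
  simp only [popRisk, popMoment, resid_eq, pow_two]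

theorem sampleMoment_zeta_z (j k : P.Idx) (ω : Ω) :
    P.sampleMoment (fun i t => P.zeta μ j i t) (fun i t => P.z i t k) ω =
      P.CRow j (P.phi μ j) ⬝ᵥ P.PsiHat ω *ᵥ Pi.single k 1 := by
  rw [← sampleMoment_linear]
  simp [sampleMoment, zeta, resid_eq, Pi.single_apply, ite_mul]

theorem sampleMoment_zeta_zeta (j : P.Idx) (ω : Ω) :
    P.sampleMoment (fun i t => P.zeta μ j i t) (fun i t => P.zeta μ j i t) ω =
      P.CRow j (P.phi μ j) ⬝ᵥ P.PsiHat ω *ᵥ P.CRow j (P.phi μ j) := by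
  rw [← sampleMoment_linear]
  simp only [sampleMoment, zeta, resid_eq]

theorem popMoment_zeta_z (hz : ∀ i t k l, Integrable (fun ω => P.z i t k ω * P.z i t l ω) μ)
    (j k : P.Idx) :
    P.popMoment μ (fun i t => P.zeta μ j i t) (fun i t => P.z i t k) =
      P.CRow j (P.phi μ j) ⬝ᵥ P.PsiZ μ *ᵥ Pi.single k 1 := by
  rw [← popMoment_linear hz]
  simp [popMoment, zeta, resid_eq, Pi.single_apply, ite_mul]

theorem popMoment_zeta_zeta (hz : ∀ i t k l, Integrable (fun ω => P.z i t k ω * P.z i t l ω) μ)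
    (j : P.Idx) :
    P.popMoment μ (fun i t => P.zeta μ j i t) (fun i t => P.zeta μ j i t) =
      P.CRow j (P.phi μ j) ⬝ᵥ P.PsiZ μ *ᵥ P.CRow j (P.phi μ j) := by
  rw [← popMoment_linear hz]
  simp only [popMoment, zeta, resid_eq]

theorem PsiZ_isHermitian : (P.PsiZ μ).IsHermitian := by
  ext k l
  simp [PsiZ, mul_comm]

theorem PsiHat_isHermitian (ω : Ω) : (P.PsiHat ω).IsHermitian := by
  ext k l
  simp [PsiHat, sampleMoment, mul_comm]

theorem _root_.Matrix.IsHermitian.dotProduct_mulVec_comm {ι : Type*} [Fintype ι]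
    {A : Matrix ι ι ℝ} (hA : A.IsHermitian) (v w : ι → ℝ) : v ⬝ᵥ A *ᵥ w = w ⬝ᵥ A *ᵥ v := by
  rw [Matrix.dotProduct_mulVec, ← Matrix.mulVec_transpose, dotProduct_comm,
    ← Matrix.conjTranspose_eq_transpose_of_trivial, hA]

/-- The population nodewise regression in terms of the inverse second moment matrix. -/
theorem CRow_phi_eq (hz : ∀ i t k l, Integrable (fun ω => P.z i t k ω * P.z i t l ω) μ) {c : ℝ}
    (hc0 : 0 < c) (hc : ∀ v, c * (v ⬝ᵥ v) ≤ v ⬝ᵥ P.PsiZ μ *ᵥ v) (j : P.Idx) :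
    0 < P.ThetaZ μ j j ∧ (∀ k, P.CRow j (P.phi μ j) k = P.ThetaZ μ j k / P.ThetaZ μ j j) ∧
      P.PsiZ μ *ᵥ P.CRow j (P.phi μ j) = Pi.single j (1 / P.ThetaZ μ j j) := by
  have hA := PsiZ_isHermitian (P := P) (μ := μ)
  have hdet := Matrix.isUnit_det_of_mul_dotProduct_le hA hc0 hc
  have hΘ : (P.ThetaZ μ).IsHermitian := hA.inv
  set u : P.Idx → ℝ := P.ThetaZ μ j with hu
  have hAu : P.PsiZ μ *ᵥ u = Pi.single j 1 := by
    have h1 : u = P.ThetaZ μ *ᵥ Pi.single j 1 := by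
      funext k
      rw [Matrix.mulVec_single_one, hu]
      have := hΘ.apply k j
      simpa using this
    rw [h1, Matrix.mulVec_mulVec, ThetaZ, Matrix.mul_nonsing_inv _ hdet, Matrix.one_mulVec]
  have hu0 : u ≠ 0 := by
    intro h
    rw [h, Matrix.mulVec_zero] at hAu
    have := congrFun hAu j
    simp at this
  have hujj : 0 < u j := by
    have h1 := hc u
    rw [hAu, dotProduct_single, mul_one] at h1
    refine lt_of_lt_of_le (mul_pos hc0 ?_) h1
    refine lt_of_le_of_ne (Finset.sum_nonneg fun i _ => mul_self_nonneg _) fun h => hu0 ?_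
    exact dotProduct_self_eq_zero.1 h.symm
  -- The row of the inverse, scaled to have `j`th entry `1`, is the candidate for `(1, -φ_j)`.
  set v : P.Idx → ℝ := (1 / u j) • u with hv
  have hvj : v j = 1 := by simp [hv, hujj.ne']
  have hAv : P.PsiZ μ *ᵥ v = Pi.single j (1 / u j) := by
    rw [hv, Matrix.mulVec_smul, hAu]
    funext k
    simp [Pi.single_apply]
  -- Pythagoras: competitors differ from `v` only off `j`, whereas `Ψ_Z v` is supported at `j`, so
  -- the cross term vanishes. Hence `v` is the unique minimizer, and the choice made in `phi` is
  -- forced.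
  have hexp : ∀ δ : P.Others j → ℝ, P.popRisk μ j δ =
      v ⬝ᵥ P.PsiZ μ *ᵥ v + (P.CRow j δ - v) ⬝ᵥ P.PsiZ μ *ᵥ (P.CRow j δ - v) := fun δ => by
    have h0 : (P.CRow j δ - v) ⬝ᵥ P.PsiZ μ *ᵥ v = 0 := by
      rw [hAv, dotProduct_single, Pi.sub_apply, CRow_self, hvj]; ring
    have h0' := h0
    rw [hA.dotProduct_mulVec_comm] at h0'
    rw [popRisk_eq hz]
    have h1 : P.CRow j δ = v + (P.CRow j δ - v) := by abel
    conv_lhs => rw [h1]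
    rw [Matrix.mulVec_add, add_dotProduct, dotProduct_add, dotProduct_add, h0, h0']
    ring
  have hnn : ∀ w : P.Idx → ℝ, 0 ≤ w ⬝ᵥ w := fun w =>
    Finset.sum_nonneg fun i _ => mul_self_nonneg _
  have hvC := eq_CRow hvj
  have hmin : ∃ δ, ∀ δ', P.popRisk μ j δ ≤ P.popRisk μ j δ' := by
    refine ⟨fun k => -v k, fun δ' => ?_⟩
    rw [hexp, hexp δ', ← hvC, sub_self, zero_dotProduct, add_zero]
    have := (mul_nonneg hc0.le (hnn _)).trans (hc (P.CRow j δ' - v))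
    linarith
  have hphi : ∀ δ', P.popRisk μ j (P.phi μ j) ≤ P.popRisk μ j δ' := Classical.epsilon_spec hmin
  have heq : P.CRow j (P.phi μ j) = v := by
    have h1 := hphi fun k => -v k
    rw [hexp, hexp (fun k => -v k), ← hvC, sub_self, zero_dotProduct, add_zero] at h1
    have h2 := hc (P.CRow j (P.phi μ j) - v)
    have h3 : (P.CRow j (P.phi μ j) - v) ⬝ᵥ (P.CRow j (P.phi μ j) - v) = 0 := by
      have := hnn (P.CRow j (P.phi μ j) - v)
      nlinarith
    exact sub_eq_zero.1 (dotProduct_self_eq_zero.1 h3)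
  refine ⟨hujj, fun k => ?_, by rw [heq, hAv]⟩
  rw [heq, hv, Pi.smul_apply, smul_eq_mul, one_div, inv_mul_eq_div]

theorem CRow_dotProduct_self (j : P.Idx) (δ : P.Others j → ℝ) :
    P.CRow j δ ⬝ᵥ P.CRow j δ = 1 + ∑ k, δ k ^ 2 := by
  rw [dotProduct, sum_idx_eq j, CRow_self, one_mul]
  congr 1
  exact Finset.sum_congr rfl fun k _ => by rw [CRow_other]; ring

/-- The facts on the population nodewise regression used below. -/
theorem popRegression (hz : ∀ i t k l, Integrable (fun ω => P.z i t k ω * P.z i t l ω) μ)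
    {c c' : ℝ} (hc0 : 0 < c) (hc : c ≤ mineval (P.PsiZ μ)) (hc' : maxeval (P.PsiZ μ) ≤ c')
    (j : P.Idx) :
    P.tauSq μ j = P.CRow j (P.phi μ j) ⬝ᵥ P.PsiZ μ *ᵥ P.CRow j (P.phi μ j) ∧
      c * (1 + ∑ k, P.phi μ j k ^ 2) ≤ P.tauSq μ j ∧ P.tauSq μ j ≤ c' ∧
      (∀ k, k ≠ j → P.CRow j (P.phi μ j) ⬝ᵥ P.PsiZ μ *ᵥ Pi.single k 1 = 0) ∧
      ∀ k, P.ThetaZ μ j k = P.CRow j (P.phi μ j) k / P.tauSq μ j := by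
  have hA := PsiZ_isHermitian (P := P) (μ := μ)
  have hquad := hA.mul_dotProduct_le_of_le_mineval hc
  obtain ⟨h1, h2, h3⟩ := CRow_phi_eq hz hc0 hquad j
  have hresid : ∀ i t, Integrable (fun ω => P.zeta μ j i t ω ^ 2) μ := fun i t => by
    have : (fun ω => P.zeta μ j i t ω ^ 2) = fun ω => ∑ k, ∑ l,
        P.CRow j (P.phi μ j) k * P.CRow j (P.phi μ j) l * (P.z i t k ω * P.z i t l ω) := by
      funext ω
      rw [zeta, resid_eq, pow_two, Finset.sum_mul_sum]
      exact Finset.sum_congr rfl fun k _ => Finset.sum_congr rfl fun l _ => by ring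
    rw [this]
    exact integrable_finsetSum _ fun k _ => integrable_finsetSum _ fun l _ =>
      (hz i t k l).const_mul _
  have hpr : P.tauSq μ j = P.popRisk μ j (P.phi μ j) := by
    rw [tauSq, integral_const_mul, popRisk, integral_finsetSum _ fun i _ =>
      integrable_finsetSum _ fun t _ => hresid i t]
    congr 1
    refine Finset.sum_congr rfl fun i _ => ?_
    rw [integral_finsetSum _ fun t _ => hresid i t]
    rfl
  have htau : P.tauSq μ j = P.CRow j (P.phi μ j) ⬝ᵥ P.PsiZ μ *ᵥ P.CRow j (P.phi μ j) := by
    rw [hpr, popRisk_eq hz]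
  have htau' : P.tauSq μ j = 1 / P.ThetaZ μ j j := by
    rw [htau, h3, dotProduct_single, CRow_self, one_mul]
  refine ⟨htau, ?_, ?_, fun k hk => ?_, fun k => ?_⟩
  · rw [htau, ← CRow_dotProduct_self]
    exact hquad _
  -- The upper bound on `τ_j²` comes from comparing the optimal regression with the zero coefficient
  -- vector.
  · have hle : (Pi.single j 1 : P.Idx → ℝ) ⬝ᵥ P.PsiZ μ *ᵥ Pi.single j 1 ≤ c' := by
      have := hA.dotProduct_le_of_maxeval_le hc' (Pi.single j 1)
      simpa using this
    refine le_trans ?_ hle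
    set v := P.CRow j (P.phi μ j)
    set e : P.Idx → ℝ := Pi.single j 1 with he
    have h0 : (e - v) ⬝ᵥ P.PsiZ μ *ᵥ v = 0 := by
      have hej : e j = 1 := by rw [he, Pi.single_eq_same]
      have hvj : v j = 1 := CRow_self j _
      rw [h3, dotProduct_single, Pi.sub_apply, hej, hvj]; ring
    have h0' := h0
    rw [hA.dotProduct_mulVec_comm] at h0'
    have h1 : e = v + (e - v) := by abel
    rw [htau]
    conv_rhs => rw [h1]
    rw [Matrix.mulVec_add, add_dotProduct, dotProduct_add, dotProduct_add, h0, h0']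
    have := (mul_nonneg hc0.le (Finset.sum_nonneg fun i _ => mul_self_nonneg _)).trans
      (hquad (e - v))
    linarith
  · rw [hA.dotProduct_mulVec_comm, h3, dotProduct_single, Pi.single_eq_of_ne (Ne.symm hk),
      zero_mul]
  · rw [h2 k, htau']
    field_simp

end DynamicPanel

/-! ### Weak sparsity, the cone condition and scalar error bounds. -/

section WeakSparsity

variable {κ : Type*} [Fintype κ]

theorem sum_abs_le_mul_l2norm {S : Finset κ} {Γ : ℝ} (hΓ : 0 ≤ Γ) (hS : (S.card : ℝ) ≤ Γ ^ 2)
    (v : κ → ℝ) : ∑ k ∈ S, |v k| ≤ Γ * l2norm v := by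
  have h0 : 0 ≤ Γ * l2norm v := mul_nonneg hΓ (Real.sqrt_nonneg _)
  refine le_of_sq_le_sq ?_ h0
  have hv : 0 ≤ ∑ k, v k ^ 2 := Finset.sum_nonneg fun k _ => sq_nonneg _
  have hl2 : l2norm v ^ 2 = ∑ k, v k ^ 2 := Real.sq_sqrt hv
  rw [mul_pow, hl2]
  calc (∑ k ∈ S, |v k|) ^ 2 ≤ S.card * ∑ k ∈ S, |v k| ^ 2 := sq_sum_le_card_mul_sum_sq
    _ ≤ Γ ^ 2 * ∑ k, v k ^ 2 := by
        simp only [sq_abs]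
        gcongr
        exact Finset.subset_univ S

/-- Weak sparsity bounds the number of large coefficients and the sum of the small ones. -/
theorem weak_sparsity_split {ϑ lam G : ℝ} (hϑ0 : 0 < ϑ) (hϑ1 : ϑ < 1) (hlam : 0 < lam)
    {f : κ → ℝ} (hf : ∑ k, |f k| ^ ϑ ≤ G) :
    ((Finset.univ.filter fun k => lam < |f k|).card : ℝ) ≤ G * lam ^ (-ϑ) ∧
      ∑ k ∈ (Finset.univ.filter fun k => ¬ lam < |f k|), |f k| ≤ G * lam ^ (-ϑ) * lam := by
  have hpos : ∀ k, 0 ≤ |f k| ^ ϑ := fun k => Real.rpow_nonneg (abs_nonneg _) _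
  have hlϑ : 0 < lam ^ ϑ := Real.rpow_pos_of_pos hlam _
  constructor
  · rw [Real.rpow_neg hlam.le, ← div_eq_mul_inv, le_div_iff₀ hlϑ, ← nsmul_eq_mul]
    refine le_trans ?_ hf
    refine le_trans (Finset.card_nsmul_le_sum _ (fun k => |f k| ^ ϑ) _ fun k hk => ?_)
      (Finset.sum_le_sum_of_subset_of_nonneg (Finset.subset_univ _) fun k _ _ => hpos k)
    exact Real.rpow_le_rpow hlam.le (Finset.mem_filter.1 hk).2.le hϑ0.le
  · have hl : lam ^ (-ϑ) * lam = lam ^ (1 - ϑ) := by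
      nth_rewrite 2 [← Real.rpow_one lam]
      rw [← Real.rpow_add hlam]; congr 1; ring
    rw [mul_assoc, hl]
    calc ∑ k ∈ (Finset.univ.filter fun k => ¬ lam < |f k|), |f k|
        ≤ ∑ k ∈ (Finset.univ.filter fun k => ¬ lam < |f k|), |f k| ^ ϑ * lam ^ (1 - ϑ) := by
          refine Finset.sum_le_sum fun k hk => ?_
          have hk' : |f k| ≤ lam := not_lt.1 (Finset.mem_filter.1 hk).2
          rcases eq_or_lt_of_le (abs_nonneg (f k)) with h0 | h0
          · rw [← h0]
            exact mul_nonneg (Real.rpow_nonneg le_rfl _) (Real.rpow_nonneg hlam.le _)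
          · calc |f k| = |f k| ^ ϑ * |f k| ^ (1 - ϑ) := by
                  rw [← Real.rpow_add h0]; simp
              _ ≤ _ := by
                  gcongr
      _ ≤ ∑ k, |f k| ^ ϑ * lam ^ (1 - ϑ) :=
          Finset.sum_le_sum_of_subset_of_nonneg (Finset.subset_univ _) fun k _ _ =>
            mul_nonneg (hpos k) (Real.rpow_nonneg hlam.le _)
      _ ≤ G * lam ^ (1 - ϑ) := by
          rw [← Finset.sum_mul]
          gcongr

/-- The cone condition implied by the basic inequality of the Lasso. -/
theorem lasso_cone [DecidableEq κ] {S : Finset κ} {Γ lam u Q : ℝ} {f g : κ → ℝ} (hΓ : 0 ≤ Γ) (hlam : 0 < lam)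
    (hS : (S.card : ℝ) ≤ Γ ^ 2) (hSc : ∑ k ∈ Sᶜ, |f k| ≤ Γ ^ 2 * lam) (hu : u ≤ lam / 4)
    (hQ : 0 ≤ Q)
    (hbasic : Q + 2 * lam * l1norm g ≤ 2 * u * l1norm (g - f) + 2 * lam * l1norm f) :
    l1norm (g - f) ≤ 4 * (Γ * l2norm (g - f) + Γ ^ 2 * lam) ∧
      Q ≤ 4 * lam * (Γ * l2norm (g - f) + Γ ^ 2 * lam) := by
  have hsplit : ∀ h : κ → ℝ, l1norm h = ∑ k ∈ S, |h k| + ∑ k ∈ Sᶜ, |h k| := fun h =>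
    (Finset.sum_add_sum_compl S fun k => |h k|).symm
  have h1 := sum_abs_le_mul_l2norm hΓ hS (g - f)
  have h2 : ∑ k ∈ S, |f k| - ∑ k ∈ S, |g k| ≤ ∑ k ∈ S, |(g - f) k| := by
    rw [← Finset.sum_sub_distrib]
    refine Finset.sum_le_sum fun k _ => ?_
    rw [Pi.sub_apply, abs_sub_comm]
    exact abs_sub_abs_le_abs_sub _ _
  have h3 : ∑ k ∈ Sᶜ, |(g - f) k| ≤ ∑ k ∈ Sᶜ, |g k| + ∑ k ∈ Sᶜ, |f k| := by
    rw [← Finset.sum_add_distrib]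
    exact Finset.sum_le_sum fun k _ => abs_sub _ _
  have h0 : 0 ≤ ∑ k ∈ Sᶜ, |(g - f) k| := Finset.sum_nonneg fun _ _ => abs_nonneg _
  have h0' : 0 ≤ ∑ k ∈ S, |(g - f) k| := Finset.sum_nonneg fun _ _ => abs_nonneg _
  rw [hsplit (g - f), hsplit f, hsplit g] at hbasic
  rw [hsplit (g - f)]
  set yS := ∑ k ∈ S, |(g - f) k|
  set yN := ∑ k ∈ Sᶜ, |(g - f) k|
  set b := ∑ k ∈ Sᶜ, |f k|
  set X := Γ * l2norm (g - f)
  set W := Γ ^ 2 * lam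
  -- The noise term costs `λ/2` times the whole `ℓ₁` error. The triangle inequality on `S` costs `2
  -- λ yS`, and on the complement it gains `2 λ yN` at the price of counting the small coefficients
  -- twice.
  have hkey : Q + 3 / 2 * lam * yN ≤ 5 / 2 * lam * yS + 4 * lam * b := by
    have e1 : 2 * u * (yS + yN) ≤ lam / 2 * (yS + yN) := by nlinarith
    nlinarith
  have hkey' : 3 / 2 * lam * yN ≤ lam * (5 / 2 * X + 4 * W) := by nlinarith
  have hyN : 3 / 2 * yN ≤ 5 / 2 * X + 4 * W := by
    refine le_of_mul_le_mul_left ?_ hlam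
    linarith
  have hX : 0 ≤ X := mul_nonneg hΓ (Real.sqrt_nonneg _)
  have hW : 0 ≤ W := by positivity
  refine ⟨by linarith, ?_⟩
  nlinarith [mul_nonneg hlam.le h0, mul_nonneg hlam.le hX]

end WeakSparsity

/-- A larger `x` would exceed `R`, and then the quadratic term would dominate everything on the
right. The additive `R` stands for the error due to coefficients that are small but not zero. -/
theorem le_mul_of_quadratic_le {c C₁ R x : ℝ} (hc : 0 < c) (hC₁ : 0 < C₁) (hR : 0 < R)
    (h : c / 2 * x ^ 2 ≤ C₁ * R * (x + R) + c / 2 * R ^ 2) : x ≤ (4 * C₁ / c + 2) * R := by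
  by_contra! hlt
  have h1 : (4 * C₁ + 2 * c) * R < c * x := by
    calc (4 * C₁ + 2 * c) * R = c * ((4 * C₁ / c + 2) * R) := by field_simp
      _ < c * x := by gcongr
  have h2 : R < x := by
    have : 0 < 4 * C₁ / c := by positivity
    nlinarith
  have h3 : 0 < x := hR.trans h2
  have h4 : (4 * C₁ + 2 * c) * R * x < c * x * x := by gcongr
  have h5 : C₁ * (R * R) < C₁ * (R * x) := by gcongr
  have h6 : c * (R * R) < c * (R * x) := by gcongr
  nlinarith

set_option maxHeartbeats 1000000 in
/-- Deterministic error bounds of the nodewise Lasso in terms of its basic inequalities. -/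
theorem exists_lasso_bounds {c c' c₀ B C₁ A : ℝ} (hc : 0 < c) (hc' : 0 < c') (hc₀ : 0 < c₀)
    (hB : 0 < B) (hC₁ : 0 < C₁) (hA : 0 < A) :
    ∃ η D : ℝ, 0 < η ∧ 0 < D ∧ ∀ Γ lam u x y f₁ f₂ Q τ e ehat h₁ : ℝ,
      c₀ ≤ Γ → 0 < lam → Γ ^ 2 * lam ≤ B → 0 ≤ u → u ≤ A * lam → u * Γ ^ 2 ≤ η →
      0 ≤ x → 0 ≤ y → 0 ≤ f₂ → 0 ≤ Q → 0 ≤ h₁ →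
      y ≤ C₁ * (Γ * x + Γ ^ 2 * lam) → Q ≤ C₁ * lam * (Γ * x + Γ ^ 2 * lam) →
      f₁ ≤ Γ * f₂ + Γ ^ 2 * lam → c * (1 + f₂ ^ 2) ≤ τ → τ ≤ c' →
      |ehat - e - Q| ≤ 2 * u * y → c * x ^ 2 ≤ Q + u * y ^ 2 → |e - τ| ≤ u →
      c ≤ ehat + u * (1 + h₁) ^ 2 → h₁ ≤ f₁ + y →
      c / 2 ≤ ehat + lam * h₁ ∧ |ehat + lam * h₁ - τ| ≤ D * (Γ * lam) ∧
        y ≤ D * (Γ ^ 2 * lam) ∧ x ≤ D * (Γ * lam) ∧ f₁ ≤ D * Γ ∧ f₂ ≤ D := by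
  set R₀ := B / c₀ with hR₀
  set F := 1 + c' / c with hF
  set C₂ := 4 * C₁ / c + 2 with hC₂
  set C₃ := C₁ * (C₂ + 1) with hC₃
  set C₄ := 1 / c₀ + (F + R₀) + C₃ * R₀ with hC₄
  have hR₀p : 0 < R₀ := by positivity
  have hFp : 0 < F := by positivity
  have hC₂p : 0 < C₂ := by positivity
  have hC₃p : 0 < C₃ := by positivity
  have hC₄p : 0 < C₄ := by positivity
  set D := C₂ + C₃ + (F + R₀) + ((2 * A + 2) * C₃ * R₀ + A / c₀ + (F + R₀)) with hD
  -- The first threshold lets half of the curvature `c x²` absorb `u y²`; the second keeps `u (1 +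
  -- h₁)²` below `c / 2`. In the application `x`, `y` are the `ℓ₂` and `ℓ₁` errors, `f₂`, `f₁` the
  -- norms of `φ_j`, `h₁` is `‖φ̂_j‖₁`, and `e`, `ehat` are the empirical risks at `φ_j` and `φ̂_j`.
  refine ⟨min (c / (4 * C₁ ^ 2)) (c / (2 * C₄ ^ 2)), D, by positivity, by positivity, ?_⟩
  intro Γ lam u x y f₁ f₂ Q τ e ehat h₁ hΓ hlam hΓB hu hul huη hx hy hf₂ hQ hh₁ hyx hQx hf₁ hτ hτ'
    hemp hcx he hlow hh
  have hΓp : 0 < Γ := hc₀.trans_le hΓ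
  have hη₁ : u * Γ ^ 2 * (4 * C₁ ^ 2) ≤ c := by
    rw [← le_div_iff₀ (by positivity)]; exact huη.trans (min_le_left _ _)
  have hη₂ : u * Γ ^ 2 * (2 * C₄ ^ 2) ≤ c := by
    rw [← le_div_iff₀ (by positivity)]; exact huη.trans (min_le_right _ _)
  set R := Γ * lam with hR
  have hRp : 0 < R := by positivity
  have hRle : R ≤ R₀ := by
    rw [hR₀, le_div_iff₀ hc₀]
    calc R * c₀ ≤ R * Γ := by gcongr
      _ = Γ ^ 2 * lam := by rw [hR]; ring
      _ ≤ B := hΓB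
  have hGR : Γ ^ 2 * lam = Γ * R := by rw [hR]; ring
  have hyx' : y ≤ C₁ * Γ * (x + R) := by rw [hGR] at hyx; linarith
  have hQx' : Q ≤ C₁ * R * (x + R) := by
    calc Q ≤ _ := hQx
      _ = _ := by rw [hR]; ring
  have hf₂F : f₂ ≤ F := by
    have h1 : 1 + f₂ ^ 2 ≤ c' / c := by rw [le_div_iff₀ hc]; linarith
    linarith [sq_nonneg (f₂ - 1)]
  have hxC : x ≤ C₂ * R := by
    have h1 : u * y ^ 2 ≤ c / 2 * (x ^ 2 + R ^ 2) := by
      calc u * y ^ 2 ≤ u * (C₁ * Γ * (x + R)) ^ 2 := by gcongr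
        _ = u * Γ ^ 2 * (4 * C₁ ^ 2) * ((x + R) ^ 2 / 4) := by ring
        _ ≤ c * ((x + R) ^ 2 / 4) := by gcongr
        _ ≤ _ := by linarith [mul_nonneg hc.le (sq_nonneg (x - R))]
    have h2 : c / 2 * x ^ 2 ≤ C₁ * R * (x + R) + c / 2 * R ^ 2 := by linarith
    exact le_mul_of_quadratic_le hc hC₁ hRp h2
  have hyC : y ≤ C₃ * (Γ * R) := by
    calc y ≤ C₁ * Γ * (x + R) := hyx'
      _ ≤ C₁ * Γ * (C₂ * R + R) := by gcongr
      _ = _ := by rw [hC₃]; ring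
  have hQC : Q ≤ C₃ * R * R₀ := by
    calc Q ≤ C₁ * R * (x + R) := hQx'
      _ ≤ C₁ * R * (C₂ * R + R) := by gcongr
      _ = C₃ * R * R := by rw [hC₃]; ring
      _ ≤ _ := by gcongr
  have hf₁C : f₁ ≤ (F + R₀) * Γ := by
    calc f₁ ≤ Γ * f₂ + Γ * R := by rw [← hGR]; exact hf₁
      _ ≤ Γ * F + Γ * R₀ := by gcongr
      _ = _ := by ring
  have hlamy : lam * y ≤ C₃ * R₀ * R := by
    calc lam * y ≤ lam * (C₃ * (Γ * R)) := by gcongr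
      _ = C₃ * R * R := by rw [hR]; ring
      _ ≤ C₃ * R₀ * R := by gcongr
  have hlamf : lam * f₁ ≤ (F + R₀) * R := by
    calc lam * f₁ ≤ lam * ((F + R₀) * Γ) := by gcongr
      _ = _ := by rw [hR]; ring
  have huR : u ≤ A / c₀ * R := by
    calc u ≤ A * lam := hul
      _ = A / c₀ * (c₀ * lam) := by field_simp
      _ ≤ A / c₀ * (Γ * lam) := by gcongr
  have huy : u * y ≤ A * (C₃ * R₀ * R) := by
    calc u * y ≤ A * lam * y := by gcongr
      _ = A * (lam * y) := by ring
      _ ≤ _ := by gcongr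
  have hDparts : 0 ≤ (2 * A + 2) * C₃ * R₀ + A / c₀ + (F + R₀) := by positivity
  refine ⟨?_, ?_, ?_, ?_, ?_, ?_⟩
  -- The `ℓ₁` norm of the estimate is itself of order `Γ`, so the smallness of `u Γ²` preserves half
  -- of the population eigenvalue bound in the empirical risk.
  · have h1 : 1 + h₁ ≤ C₄ * Γ := by
      have e1 : 1 ≤ 1 / c₀ * Γ := by rw [one_div, inv_mul_eq_div, le_div_iff₀ hc₀]; linarith
      have e2 : C₃ * (Γ * R) ≤ C₃ * R₀ * Γ := by
        calc C₃ * (Γ * R) ≤ C₃ * (Γ * R₀) := by gcongr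
          _ = _ := by ring
      calc 1 + h₁ ≤ 1 / c₀ * Γ + ((F + R₀) * Γ + C₃ * R₀ * Γ) := by linarith
        _ = C₄ * Γ := by rw [hC₄]; ring
    have h2 : u * (1 + h₁) ^ 2 ≤ c / 2 := by
      calc u * (1 + h₁) ^ 2 ≤ u * (C₄ * Γ) ^ 2 := by gcongr
        _ = u * Γ ^ 2 * (2 * C₄ ^ 2) / 2 := by ring
        _ ≤ c / 2 := by gcongr
    have h3 : 0 ≤ lam * h₁ := by positivity
    linarith
  · have h1 : lam * h₁ ≤ (F + R₀) * R + C₃ * R₀ * R := by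
      calc lam * h₁ ≤ lam * (f₁ + y) := by gcongr
        _ ≤ _ := by linarith
    have h3 : 0 ≤ lam * h₁ := by positivity
    have h4 : ((2 * A + 2) * C₃ * R₀ + A / c₀ + (F + R₀)) * R ≤ D * R := by
      have : 0 ≤ C₂ + C₃ + (F + R₀) := by positivity
      exact mul_le_mul_of_nonneg_right (by linarith) hRp.le
    have h5 := abs_le.1 hemp
    have h6 := abs_le.1 he
    rw [abs_le]
    constructor
    · linarith
    · linarith
  · rw [hGR]
    refine hyC.trans ?_
    gcongr
    linarith
  · refine hxC.trans ?_
    gcongr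
    linarith
  · refine hf₁C.trans ?_
    gcongr
    linarith
  · linarith

/-! ### Norm inequalities and perturbation of quadratic forms. -/

section

open scoped Matrix

variable {ι : Type*} [Fintype ι]

/-- Entrywise closeness controls quadratic forms through the `ℓ₁` norm; this is how population
eigenvalue bounds reach the sample matrix. -/
theorem abs_dotProduct_mulVec_sub_le {A B : Matrix ι ι ℝ} {u : ℝ}
    (h : ∀ k l, |A k l - B k l| ≤ u) (v : ι → ℝ) :
    |v ⬝ᵥ A *ᵥ v - v ⬝ᵥ B *ᵥ v| ≤ u * l1norm v ^ 2 := by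
  have h1 : v ⬝ᵥ A *ᵥ v - v ⬝ᵥ B *ᵥ v = ∑ k, ∑ l, v k * v l * (A k l - B k l) := by
    simp only [dotProduct, Matrix.mulVec, Finset.mul_sum, ← Finset.sum_sub_distrib]
    exact Finset.sum_congr rfl fun k _ => Finset.sum_congr rfl fun l _ => by ring
  rw [h1]
  calc |∑ k, ∑ l, v k * v l * (A k l - B k l)|
      ≤ ∑ k, ∑ l, |v k| * |v l| * u := by
        refine (Finset.abs_sum_le_sum_abs _ _).trans (Finset.sum_le_sum fun k _ => ?_)
        refine (Finset.abs_sum_le_sum_abs _ _).trans (Finset.sum_le_sum fun l _ => ?_)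
        rw [abs_mul, abs_mul]
        gcongr
        exact h k l
    _ = u * l1norm v ^ 2 := by
        simp only [← Finset.sum_mul, ← Finset.mul_sum, l1norm]
        ring

theorem dotProduct_mulVec_eq_sum [DecidableEq ι] (A : Matrix ι ι ℝ) (v d : ι → ℝ) :
    v ⬝ᵥ A *ᵥ d = ∑ k, (v ⬝ᵥ A *ᵥ Pi.single k 1) * d k := by
  simp only [Matrix.dotProduct_mulVec, dotProduct_single, mul_one]
  rfl

theorem l1norm_nonneg (v : ι → ℝ) : 0 ≤ l1norm v := Finset.sum_nonneg fun _ _ => abs_nonneg _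

theorem l2norm_nonneg (v : ι → ℝ) : 0 ≤ l2norm v := Real.sqrt_nonneg _

theorem l2norm_sq (v : ι → ℝ) : l2norm v ^ 2 = ∑ k, v k ^ 2 :=
  Real.sq_sqrt (Finset.sum_nonneg fun _ _ => sq_nonneg _)

theorem l1norm_add_le (v w : ι → ℝ) : l1norm (v + w) ≤ l1norm v + l1norm w := by
  unfold l1norm
  rw [← Finset.sum_add_distrib]
  exact Finset.sum_le_sum fun _ _ => abs_add_le _ _

theorem l1norm_smul (a : ℝ) (v : ι → ℝ) : l1norm (a • v) = |a| * l1norm v := by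
  simp [l1norm, abs_mul, Finset.mul_sum]

theorem l2norm_smul_add_smul_le (a b : ℝ) (v w : ι → ℝ) :
    l2norm (a • v + b • w) ≤ 2 * (|a| * l2norm v + |b| * l2norm w) := by
  have hv := l2norm_nonneg v
  have hw := l2norm_nonneg w
  have h0 : 0 ≤ 2 * (|a| * l2norm v + |b| * l2norm w) := by positivity
  refine le_of_sq_le_sq ?_ h0
  have h1 : l2norm (a • v + b • w) ^ 2 ≤ 2 * (a ^ 2 * l2norm v ^ 2 + b ^ 2 * l2norm w ^ 2) := by
    rw [l2norm_sq, l2norm_sq, l2norm_sq, Finset.mul_sum, Finset.mul_sum, ← Finset.sum_add_distrib,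
      Finset.mul_sum]
    refine Finset.sum_le_sum fun k _ => ?_
    simp only [Pi.add_apply, Pi.smul_apply, smul_eq_mul]
    linarith [sq_nonneg (a * v k - b * w k)]
  refine h1.trans ?_
  rw [← sq_abs a, ← sq_abs b]
  have h2 : 0 ≤ |a| * l2norm v * (|b| * l2norm w) := by positivity
  have h3 : 0 ≤ (|a| * l2norm v) ^ 2 := by positivity
  have h4 : 0 ≤ (|b| * l2norm w) ^ 2 := by positivity
  linarith

end

/-! ### From small moment deviations to bounds for the nodewise Lasso. -/

namespace DynamicPanel

open scoped Matrix

variable {Ω : Type*} [mΩ : MeasurableSpace Ω] {P : DynamicPanel Ω} {μ : Measure Ω}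

theorem l1norm_CRow (j : P.Idx) (δ : P.Others j → ℝ) : l1norm (P.CRow j δ) = 1 + l1norm δ := by
  rw [l1norm, sum_idx_eq j, CRow_self, abs_one]
  congr 1
  exact Finset.sum_congr rfl fun k _ => by rw [CRow_other, abs_neg]

theorem l2norm_CRow_le (j : P.Idx) (δ : P.Others j → ℝ) :
    l2norm (P.CRow j δ) ≤ 1 + l2norm δ := by
  have h0 : 0 ≤ 1 + l2norm δ := by linarith [l2norm_nonneg δ]
  refine le_of_sq_le_sq ?_ h0
  have h1 : l2norm (P.CRow j δ) ^ 2 = 1 + l2norm δ ^ 2 := by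
    rw [l2norm_sq, l2norm_sq, ← CRow_dotProduct_self j]
    exact Finset.sum_congr rfl fun k _ => pow_two _
  rw [h1]
  linarith [l2norm_nonneg δ]

theorem l1norm_CRow_sub (j : P.Idx) (δ δ' : P.Others j → ℝ) :
    l1norm (P.CRow j δ - P.CRow j δ') = l1norm (δ - δ') := by
  rw [l1norm, sum_idx_eq j, Pi.sub_apply, CRow_self, CRow_self, sub_self, abs_zero, zero_add]
  refine Finset.sum_congr rfl fun k _ => ?_
  rw [Pi.sub_apply, CRow_other, CRow_other, Pi.sub_apply, ← abs_neg]; congr 1; ring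

theorem dotProduct_CRow_sub (j : P.Idx) (δ δ' : P.Others j → ℝ) :
    (P.CRow j δ - P.CRow j δ') ⬝ᵥ (P.CRow j δ - P.CRow j δ') = l2norm (δ - δ') ^ 2 := by
  rw [l2norm_sq, dotProduct, sum_idx_eq j, Pi.sub_apply, CRow_self, CRow_self, sub_self, mul_zero,
    zero_add]
  refine Finset.sum_congr rfl fun k _ => ?_
  rw [Pi.sub_apply, CRow_other, CRow_other, Pi.sub_apply]; ring

theorem l2norm_CRow_sub (j : P.Idx) (δ δ' : P.Others j → ℝ) :
    l2norm (P.CRow j δ - P.CRow j δ') = l2norm (δ - δ') := by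
  refine (sq_eq_sq₀ (l2norm_nonneg _) (l2norm_nonneg _)).1 ?_
  rw [← dotProduct_CRow_sub, l2norm_sq]
  exact Finset.sum_congr rfl fun k _ => pow_two _

theorem PsiHat_quad_nonneg (ω : Ω) (v : P.Idx → ℝ) : 0 ≤ v ⬝ᵥ P.PsiHat ω *ᵥ v := by
  rw [← sampleMoment_linear, sampleMoment]
  exact mul_nonneg (by positivity)
    (Finset.sum_nonneg fun i _ => Finset.sum_nonneg fun t _ => mul_self_nonneg _)

/-- The deterministic consequences of small moment deviations for the nodewise Lasso. -/
theorem MomentsClose.basic_inequalities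
    (hz : ∀ i t k l, Integrable (fun ω => P.z i t k ω * P.z i t l ω) μ)
    {c c' : ℝ} (hc0 : 0 < c) (hc : c ≤ mineval (P.PsiZ μ)) (hc' : maxeval (P.PsiZ μ) ≤ c')
    {u lam : ℝ} {ω : Ω} (hu : P.MomentsClose μ u ω) (hu0 : 0 ≤ u) {j : P.Idx}
    {g : P.Others j → ℝ} (hg : P.IsNodewiseLasso lam j ω g) :
    ∃ Q : ℝ, 0 ≤ Q ∧
      |P.empRisk j ω g - P.empRisk j ω (P.phi μ j) - Q| ≤ 2 * u * l1norm (g - P.phi μ j) ∧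
      Q + 2 * lam * l1norm g ≤ 2 * u * l1norm (g - P.phi μ j) + 2 * lam * l1norm (P.phi μ j) ∧
      c * l2norm (g - P.phi μ j) ^ 2 ≤ Q + u * l1norm (g - P.phi μ j) ^ 2 ∧
      |P.empRisk j ω (P.phi μ j) - P.tauSq μ j| ≤ u ∧
      c ≤ P.empRisk j ω g + u * (1 + l1norm g) ^ 2 := by
  obtain ⟨htau, -, -, hortho, -⟩ := popRegression hz hc0 hc hc' j
  have hquad := (PsiZ_isHermitian (P := P) (μ := μ)).mul_dotProduct_le_of_le_mineval hc
  have hclose : ∀ k l, |P.PsiHat ω k l - P.PsiZ μ k l| ≤ u := fun k l => hu (Sum.inl k) (Sum.inl l)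
  set v := P.CRow j (P.phi μ j) with hv
  set d := P.CRow j g - v with hd
  have hdj : d j = 0 := by rw [hd, Pi.sub_apply, hv, CRow_self, CRow_self, sub_self]
  -- The score of the Lasso: `ζ_j` is orthogonal in population to every other regressor, so its
  -- sample moments with them are at most `u`. Its moment with `z_j` is not small, but `d` vanishes
  -- at `j`.
  have hcross : |v ⬝ᵥ P.PsiHat ω *ᵥ d| ≤ u * l1norm (g - P.phi μ j) := by
    rw [dotProduct_mulVec_eq_sum, ← l1norm_CRow_sub j g, l1norm, Finset.mul_sum]
    refine (Finset.abs_sum_le_sum_abs _ _).trans (Finset.sum_le_sum fun k _ => ?_)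
    rw [abs_mul]
    by_cases hk : k = j
    · rw [hk, hdj, abs_zero, mul_zero]
      exact mul_nonneg hu0 (abs_nonneg _)
    · refine mul_le_mul_of_nonneg_right ?_ (abs_nonneg _)
      have h1 := hu (Sum.inr j) (Sum.inl k)
      have h2 := sampleMoment_zeta_z (P := P) (μ := μ) j k ω
      have h3 := popMoment_zeta_z hz j k
      rw [hortho k hk] at h3
      simp only [nodewise] at h1
      rwa [h2, h3, sub_zero] at h1
  have hexp : P.empRisk j ω g = P.empRisk j ω (P.phi μ j) + 2 * (v ⬝ᵥ P.PsiHat ω *ᵥ d)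
      + d ⬝ᵥ P.PsiHat ω *ᵥ d := by
    rw [empRisk_eq, empRisk_eq, ← hv]
    have h1 : P.CRow j g = v + d := by rw [hd]; abel
    rw [h1, Matrix.mulVec_add, add_dotProduct, dotProduct_add, dotProduct_add,
      (PsiHat_isHermitian ω).dotProduct_mulVec_comm d v]
    ring
  have hc1 := abs_le.1 hcross
  refine ⟨d ⬝ᵥ P.PsiHat ω *ᵥ d, PsiHat_quad_nonneg ω d, ?_, ?_, ?_, ?_, ?_⟩
  · rw [hexp, abs_le]
    constructor <;> linarith
  · have := hg (P.phi μ j)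
    rw [hexp] at this
    unfold l1norm at hc1 ⊢
    linarith
  · have h1 := hquad d
    rw [hd, hv, dotProduct_CRow_sub, ← hv, ← hd] at h1
    have h2 := abs_le.1 (abs_dotProduct_mulVec_sub_le hclose d)
    rw [hd, hv, l1norm_CRow_sub, ← hv, ← hd] at h2
    linarith
  · rw [empRisk_eq, htau, ← popMoment_zeta_zeta hz, ← sampleMoment_zeta_zeta]
    exact hu (Sum.inr j) (Sum.inr j)
  · have h1 := hquad (P.CRow j g)
    have h2 := abs_le.1 (abs_dotProduct_mulVec_sub_le hclose (P.CRow j g))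
    rw [l1norm_CRow, ← empRisk_eq] at h2
    rw [CRow_dotProduct_self] at h1
    have h3 : 0 ≤ c * ∑ k, g k ^ 2 := mul_nonneg hc0.le (Finset.sum_nonneg fun _ _ => sq_nonneg _)
    linarith

/-- Error bounds of the nodewise regression for index `j`, with rates expressed by the square root
`Γ` of the effective sparsity. -/
structure NodewiseBounds (P : DynamicPanel Ω) (μ : Measure Ω) (lam : ℝ) (j : P.Idx) (ω : Ω)
    (g : P.Others j → ℝ) (Γ D : ℝ) : Prop where
  tauHat_pos : 0 < P.tauHatSq lam j ω g
  tau_diff : |P.tauHatSq lam j ω g - P.tauSq μ j| ≤ D * (Γ * lam)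
  inv_le : 1 / P.tauHatSq lam j ω g ≤ D
  inv_diff : |1 / P.tauHatSq lam j ω g - 1 / P.tauSq μ j| ≤ D * (Γ * lam)
  theta_l1 : l1norm (fun k => P.ThetaHat lam j ω g k - P.ThetaZ μ j k) ≤ D * (Γ ^ 2 * lam)
  theta_l2 : l2norm (fun k => P.ThetaHat lam j ω g k - P.ThetaZ μ j k) ≤ D * (Γ * lam)
  thetaHat_l1 : l1norm (P.ThetaHat lam j ω g) ≤ D * Γ

/-- Allows rates stated for one effective sparsity, such as `p₀` when the dimension is bounded, to
be restated for another at the cost of a larger constant. -/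
theorem NodewiseBounds.mono {lam : ℝ} {j : P.Idx} {ω : Ω} {g : P.Others j → ℝ} {Γ D Γ' D' : ℝ}
    (h : P.NodewiseBounds μ lam j ω g Γ D) (hlam : 0 ≤ lam)
    (hD : D ≤ D') (h1 : D * Γ ≤ D' * Γ') (h2 : D * Γ ^ 2 ≤ D' * Γ' ^ 2) :
    P.NodewiseBounds μ lam j ω g Γ' D' := by
  have e1 : D * (Γ * lam) ≤ D' * (Γ' * lam) := by
    rw [← mul_assoc, ← mul_assoc]; gcongr
  have e2 : D * (Γ ^ 2 * lam) ≤ D' * (Γ' ^ 2 * lam) := by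
    rw [← mul_assoc, ← mul_assoc]; gcongr
  exact ⟨h.1, h.2.trans e1, h.3.trans hD, h.4.trans e1, h.5.trans e2, h.6.trans e1, h.7.trans h1⟩

end DynamicPanel

/-- Passing from the bounds for the nodewise coefficients to those for the rows of `Θ`. -/
theorem DynamicPanel.nodewiseBounds_of_coefficient_bounds {Ω : Type*} [MeasurableSpace Ω]
    {P : DynamicPanel Ω} {μ : Measure Ω} {c c₀ B D lam Γ : ℝ} {j : P.Idx} {ω : Ω}
    {g : P.Others j → ℝ} (hc : 0 < c) (hc₀ : 0 < c₀) (hB : 0 < B) (hD : 0 < D) (hΓ : c₀ ≤ Γ)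
    (hlam : 0 < lam) (hΓB : Γ ^ 2 * lam ≤ B)
    (hΘ : ∀ k, P.ThetaZ μ j k = P.CRow j (P.phi μ j) k / P.tauSq μ j) (hτ : c ≤ P.tauSq μ j)
    (hτhat : c / 2 ≤ P.tauHatSq lam j ω g)
    (hdiff : |P.tauHatSq lam j ω g - P.tauSq μ j| ≤ D * (Γ * lam))
    (hy : l1norm (g - P.phi μ j) ≤ D * (Γ ^ 2 * lam))
    (hx : l2norm (g - P.phi μ j) ≤ D * (Γ * lam))
    (hf₁ : l1norm (P.phi μ j) ≤ D * Γ) (hf₂ : l2norm (P.phi μ j) ≤ D) :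
    P.NodewiseBounds μ lam j ω g Γ (D + 2 / c + 2 / c ^ 2 * D
      + (2 / c * D + (1 / c₀ + D) * (2 / c ^ 2 * D))
      + 2 * (2 / c * D + (1 + D) * (2 / c ^ 2 * D))
      + 2 / c * (1 / c₀ + D + D * (B / c₀))) := by
  set τ := P.tauSq μ j with hτd
  set σ := P.tauHatSq lam j ω g with hσ
  set f := P.phi μ j with hf
  have hτ0 : 0 < τ := hc.trans_le hτ
  have hσ0 : 0 < σ := (by positivity : 0 < c / 2).trans_le hτhat
  have hΓ0 : 0 < Γ := hc₀.trans_le hΓ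
  have hR0 : 0 < Γ * lam := by positivity
  have hΓR0 : 0 < Γ ^ 2 * lam := by positivity
  have hRle : Γ * lam ≤ B / c₀ := by
    rw [le_div_iff₀ hc₀]
    calc Γ * lam * c₀ ≤ Γ * lam * Γ := by gcongr
      _ = Γ ^ 2 * lam := by ring
      _ ≤ B := hΓB
  have hone : 1 ≤ 1 / c₀ * Γ := by rw [one_div, inv_mul_eq_div, le_div_iff₀ hc₀]; linarith
  have hinv : 1 / σ ≤ 2 / c := by
    rw [div_le_div_iff₀ hσ0 hc]; linarith
  have hinvd : |1 / σ - 1 / τ| ≤ 2 / c ^ 2 * D * (Γ * lam) := by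
    have h1 : 1 / σ - 1 / τ = (1 / σ) * (1 / τ) * (τ - σ) := by field_simp
    have h2 : 1 / τ ≤ 1 / c := one_div_le_one_div_of_le hc hτ
    rw [h1, abs_mul, abs_sub_comm, abs_of_pos (by positivity : 0 < 1 / σ * (1 / τ))]
    calc 1 / σ * (1 / τ) * |σ - τ| ≤ 2 / c * (1 / c) * (D * (Γ * lam)) := by gcongr
      _ = _ := by field_simp
  set I := 2 / c ^ 2 * D with hI
  have hI0 : 0 < I := by positivity
  have hσabs : |1 / σ| ≤ 2 / c := by rwa [abs_of_pos (by positivity)]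
  -- The error of the row separates into the error of the coefficients, scaled by the bounded `1 /
  -- τ̂_j²`, and the error of the scale times the population row `(1, -φ_j)`.
  have hΘdiff : (fun k => P.ThetaHat lam j ω g k - P.ThetaZ μ j k) =
      (1 / σ) • (P.CRow j g - P.CRow j f) + (1 / σ - 1 / τ) • P.CRow j f := by
    funext k
    simp only [DynamicPanel.ThetaHat, hΘ, Pi.add_apply, Pi.smul_apply, Pi.sub_apply, smul_eq_mul,
      ← hσ]
    ring
  have hΘhat : P.ThetaHat lam j ω g = (1 / σ) • P.CRow j g := by
    funext k
    simp only [DynamicPanel.ThetaHat, Pi.smul_apply, smul_eq_mul, ← hσ]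
    ring
  have p1 : 0 < 2 / c := by positivity
  have p2 : 0 < 2 / c * D + (1 / c₀ + D) * I := by positivity
  have p3 : 0 < 2 * (2 / c * D + (1 + D) * I) := by positivity
  have p4 : 0 < 2 / c * (1 / c₀ + D + D * (B / c₀)) := by positivity
  have hy0 := l1norm_nonneg (g - f)
  have hx0 := l2norm_nonneg (g - f)
  refine ⟨hσ0, hdiff.trans ?_, by linarith, hinvd.trans ?_, ?_, ?_, ?_⟩
  · exact mul_le_mul_of_nonneg_right (by linarith) hR0.le
  · exact mul_le_mul_of_nonneg_right (by linarith) hR0.le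
  · refine le_trans (b := (2 / c * D + (1 / c₀ + D) * I) * (Γ ^ 2 * lam)) ?_
      (mul_le_mul_of_nonneg_right (by linarith) hΓR0.le)
    rw [hΘdiff]
    refine (l1norm_add_le _ _).trans ?_
    rw [l1norm_smul, l1norm_smul, DynamicPanel.l1norm_CRow_sub, DynamicPanel.l1norm_CRow]
    have hv : 1 + l1norm f ≤ (1 / c₀ + D) * Γ := by linarith
    have hv0 : 0 ≤ 1 + l1norm f := by linarith [l1norm_nonneg f]
    calc |1 / σ| * l1norm (g - f) + |1 / σ - 1 / τ| * (1 + l1norm f)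
        ≤ 2 / c * (D * (Γ ^ 2 * lam)) + I * (Γ * lam) * ((1 / c₀ + D) * Γ) := by gcongr
      _ = _ := by ring
  · refine le_trans (b := 2 * (2 / c * D + (1 + D) * I) * (Γ * lam)) ?_
      (mul_le_mul_of_nonneg_right (by linarith) hR0.le)
    rw [hΘdiff]
    refine (l2norm_smul_add_smul_le _ _ _ _).trans ?_
    rw [DynamicPanel.l2norm_CRow_sub]
    have hv : l2norm (P.CRow j f) ≤ 1 + D := (DynamicPanel.l2norm_CRow_le j f).trans (by linarith)
    have hv0 := l2norm_nonneg (P.CRow j f)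
    calc 2 * (|1 / σ| * l2norm (g - f) + |1 / σ - 1 / τ| * l2norm (P.CRow j f))
        ≤ 2 * (2 / c * (D * (Γ * lam)) + I * (Γ * lam) * (1 + D)) := by gcongr
      _ = _ := by ring
  · refine le_trans (b := 2 / c * (1 / c₀ + D + D * (B / c₀)) * Γ) ?_
      (mul_le_mul_of_nonneg_right (by linarith) hΓ0.le)
    rw [hΘhat, l1norm_smul, DynamicPanel.l1norm_CRow]
    have hg : l1norm g ≤ l1norm f + l1norm (g - f) := by
      calc l1norm g = l1norm (f + (g - f)) := by congr 1; abel
        _ ≤ _ := l1norm_add_le _ _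
    have hy' : D * (Γ ^ 2 * lam) ≤ D * (B / c₀) * Γ := by
      calc D * (Γ ^ 2 * lam) = D * (Γ * lam) * Γ := by ring
        _ ≤ _ := by gcongr
    have hg1 : 1 + l1norm g ≤ (1 / c₀ + D + D * (B / c₀)) * Γ := by linarith
    have hg0 : 0 ≤ 1 + l1norm g := by linarith [l1norm_nonneg g]
    calc |1 / σ| * (1 + l1norm g) ≤ 2 / c * ((1 / c₀ + D + D * (B / c₀)) * Γ) := by gcongr
      _ = _ := by ring

/-- Deterministic bounds for the nodewise Lasso when the moment deviations are small and a cone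
condition follows from the basic inequality. -/
theorem DynamicPanel.exists_nodewiseBounds {c c' c₀ B C₁ A : ℝ} (hc : 0 < c) (hc' : 0 < c')
    (hc₀ : 0 < c₀) (hB : 0 < B) (hC₁ : 0 < C₁) (hA : 0 < A) :
    ∃ η D : ℝ, 0 < η ∧ 0 < D ∧ ∀ {Ω : Type*} [MeasurableSpace Ω] (P : DynamicPanel Ω)
      (μ : Measure Ω), (∀ i t k l, Integrable (fun ω => P.z i t k ω * P.z i t l ω) μ) →
      c ≤ mineval (P.PsiZ μ) → maxeval (P.PsiZ μ) ≤ c' →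
      ∀ (Γ lam u : ℝ) (j : P.Idx) (ω : Ω) (g : P.Others j → ℝ),
      c₀ ≤ Γ → 0 < lam → Γ ^ 2 * lam ≤ B → 0 ≤ u → u ≤ A * lam → u * Γ ^ 2 ≤ η →
      P.MomentsClose μ u ω → P.IsNodewiseLasso lam j ω g →
      (∀ Q, 0 ≤ Q →
        Q + 2 * lam * l1norm g ≤ 2 * u * l1norm (g - P.phi μ j) + 2 * lam * l1norm (P.phi μ j) →
        l1norm (g - P.phi μ j) ≤ C₁ * (Γ * l2norm (g - P.phi μ j) + Γ ^ 2 * lam) ∧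
          Q ≤ C₁ * lam * (Γ * l2norm (g - P.phi μ j) + Γ ^ 2 * lam)) →
      l1norm (P.phi μ j) ≤ Γ * l2norm (P.phi μ j) + Γ ^ 2 * lam →
      P.NodewiseBounds μ lam j ω g Γ D := by
  obtain ⟨η, D, hη, hD, hmain⟩ := exists_lasso_bounds hc hc' hc₀ hB hC₁ hA
  refine ⟨η, D + 2 / c + 2 / c ^ 2 * D
      + (2 / c * D + (1 / c₀ + D) * (2 / c ^ 2 * D))
      + 2 * (2 / c * D + (1 + D) * (2 / c ^ 2 * D))
      + 2 / c * (1 / c₀ + D + D * (B / c₀)), hη, by positivity, ?_⟩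
  intro Ω _ P μ hz hmin hmax Γ lam u j ω g hΓ hlam hΓB hu hul huη hclose hg hcone hf₁
  obtain ⟨Q, hQ, h1, h2, h3, h4, h5⟩ := hclose.basic_inequalities hz hc hmin hmax hu hg
  obtain ⟨-, hτ, hτ', -, hΘ⟩ := popRegression hz hc hmin hmax j
  obtain ⟨hy, hQ'⟩ := hcone Q hQ h2
  rw [← l2norm_sq] at hτ
  have hg1 : l1norm g ≤ l1norm (P.phi μ j) + l1norm (g - P.phi μ j) := by
    calc l1norm g = l1norm (P.phi μ j + (g - P.phi μ j)) := by congr 1; abel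
      _ ≤ _ := l1norm_add_le _ _
  obtain ⟨b1, b2, b3, b4, b5, b6⟩ := hmain Γ lam u _ _ _ _ Q _ _ _ _ hΓ hlam hΓB hu hul huη
    (l2norm_nonneg (g - P.phi μ j)) (l1norm_nonneg (g - P.phi μ j))
    (l2norm_nonneg (P.phi μ j)) hQ (l1norm_nonneg g) hy hQ' hf₁ hτ hτ' h1 h3 h4 h5 hg1
  have hτc : c ≤ P.tauSq μ j := by
    have := mul_nonneg hc.le (sq_nonneg (l2norm (P.phi μ j)))
    linarith
  exact nodewiseBounds_of_coefficient_bounds hc hc₀ hB hD hΓ hlam hΓB hΘ hτc b1 b2 b3 b4 b5 b6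

/-! ### The two regimes: dominant penalty and bounded dimension. -/

/-- Bounds for many regressors: the deviations are small relative to the penalty. -/
theorem DynamicPanel.exists_nodewiseBounds_of_weak_sparsity {c c' c₀ B ϑ : ℝ} (hc : 0 < c)
    (hc' : 0 < c') (hc₀ : 0 < c₀) (hB : 0 < B) (hϑ0 : 0 < ϑ) (hϑ1 : ϑ < 1) :
    ∃ η D : ℝ, 0 < η ∧ 0 < D ∧ ∀ {Ω : Type*} [MeasurableSpace Ω] (P : DynamicPanel Ω)
      (μ : Measure Ω), (∀ i t k l, Integrable (fun ω => P.z i t k ω * P.z i t l ω) μ) →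
      c ≤ mineval (P.PsiZ μ) → maxeval (P.PsiZ μ) ≤ c' →
      ∀ (Γ lam u G : ℝ) (j : P.Idx) (ω : Ω) (g : P.Others j → ℝ),
      c₀ ≤ Γ → 0 < lam → Γ ^ 2 = G * lam ^ (-ϑ) → Γ ^ 2 * lam ≤ B → 0 ≤ u → u ≤ η * lam →
      ∑ k, |P.phi μ j k| ^ ϑ ≤ G →
      P.MomentsClose μ u ω → P.IsNodewiseLasso lam j ω g →
      P.NodewiseBounds μ lam j ω g Γ D := by
  obtain ⟨η, D, hη, hD, hmain⟩ := DynamicPanel.exists_nodewiseBounds hc hc' hc₀ hB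
    (by norm_num : (0 : ℝ) < 4) (by norm_num : (0 : ℝ) < 1 / 4)
  -- `1/4` is what the cone argument needs; `η / B` turns `Γ² λ ≤ B` into `u Γ² ≤ η`.
  refine ⟨min (1 / 4) (η / B), D, by positivity, hD, ?_⟩
  intro Ω _ P μ hz hmin hmax Γ lam u G j ω g hΓ hlam hΓG hΓB hu hul hG hclose hg
  classical
  have hΓ0 : 0 ≤ Γ := hc₀.le.trans hΓ
  have hu1 : u ≤ 1 / 4 * lam :=
    hul.trans (mul_le_mul_of_nonneg_right (min_le_left _ _) hlam.le)
  have hu2 : u ≤ η / B * lam :=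
    hul.trans (mul_le_mul_of_nonneg_right (min_le_right _ _) hlam.le)
  have huη : u * Γ ^ 2 ≤ η := by
    calc u * Γ ^ 2 ≤ η / B * lam * Γ ^ 2 := by gcongr
      _ = η / B * (Γ ^ 2 * lam) := by ring
      _ ≤ η / B * B := by gcongr
      _ = η := by field_simp
  obtain ⟨hS, hSc⟩ := weak_sparsity_split hϑ0 hϑ1 hlam hG
  rw [← hΓG] at hS hSc
  rw [← Finset.compl_filter] at hSc
  refine hmain P μ hz hmin hmax Γ lam u j ω g hΓ hlam hΓB hu hu1 huη hclose hg
    (fun Q hQ hbasic => lasso_cone hΓ0 hlam hS hSc (by linarith) hQ hbasic) ?_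
  rw [l1norm, ← Finset.sum_add_sum_compl (Finset.univ.filter fun k => lam < |P.phi μ j k|)]
  exact add_le_add (sum_abs_le_mul_l2norm hΓ0 hS _) hSc

/-- Bounds for boundedly many regressors. -/
theorem DynamicPanel.exists_nodewiseBounds_of_p_le {c c' A lamMax : ℝ} (hc : 0 < c)
    (hc' : 0 < c') (hA : 0 < A) (hlamMax : 0 < lamMax) {p₀ : ℝ} (hp₀ : 1 ≤ p₀) :
    ∃ η D : ℝ, 0 < η ∧ 0 < D ∧ ∀ {Ω : Type*} [MeasurableSpace Ω] (P : DynamicPanel Ω)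
      (μ : Measure Ω), (∀ i t k l, Integrable (fun ω => P.z i t k ω * P.z i t l ω) μ) →
      c ≤ mineval (P.PsiZ μ) → maxeval (P.PsiZ μ) ≤ c' → (P.p : ℝ) ≤ p₀ →
      ∀ (lam u : ℝ) (j : P.Idx) (ω : Ω) (g : P.Others j → ℝ),
      0 < lam → lam ≤ lamMax → 0 ≤ u → u ≤ A * lam → u ≤ η →
      P.MomentsClose μ u ω → P.IsNodewiseLasso lam j ω g →
      P.NodewiseBounds μ lam j ω g (Real.sqrt p₀) D := by
  have hp0 : 0 < p₀ := by linarith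
  obtain ⟨η, D, hη, hD, hmain⟩ := DynamicPanel.exists_nodewiseBounds hc hc' one_pos
    (by positivity : 0 < p₀ * lamMax) (by positivity : 0 < 2 * (A + 1)) hA
  refine ⟨η / p₀, D, by positivity, hD, ?_⟩
  intro Ω _ P μ hz hmin hmax hp lam u j ω g hlam hlamM hu hul huη hclose hg
  have hsq : Real.sqrt p₀ ^ 2 = p₀ := Real.sq_sqrt hp0.le
  have hcard : ((Finset.univ : Finset (P.Others j)).card : ℝ) ≤ Real.sqrt p₀ ^ 2 := by
    rw [hsq]
    refine le_trans ?_ hp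
    rw [Finset.card_univ]
    have : Fintype.card (P.Others j) ≤ Fintype.card P.Idx := Fintype.card_subtype_le _
    have h2 : Fintype.card P.Idx = P.p := by simp [DynamicPanel.p]
    exact_mod_cast h2 ▸ this
  have hcs : ∀ v : P.Others j → ℝ, l1norm v ≤ Real.sqrt p₀ * l2norm v := fun v =>
    sum_abs_le_mul_l2norm (Real.sqrt_nonneg _) hcard v
  have hW : 0 ≤ Real.sqrt p₀ ^ 2 * lam := by positivity
  refine hmain P μ hz hmin hmax _ lam u j ω g (Real.one_le_sqrt.2 hp₀) hlam
    (by rw [hsq]; gcongr) hu hul (by rw [hsq]; rwa [le_div_iff₀ hp0] at huη) hclose hg ?_ ?_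
  -- All coordinates are treated as active, so Cauchy–Schwarz replaces the cone, and `u` need only
  -- be a multiple of `λ`, not a small one.
  · intro Q hQ hbasic
    have h1 := hcs (g - P.phi μ j)
    have h0 := l1norm_nonneg (g - P.phi μ j)
    have hle : l1norm (P.phi μ j) ≤ l1norm g + l1norm (g - P.phi μ j) := by
      calc l1norm (P.phi μ j) = l1norm (g + (-1 : ℝ) • (g - P.phi μ j)) := by
            congr 1; funext k; simp
        _ ≤ l1norm g + l1norm ((-1 : ℝ) • (g - P.phi μ j)) := l1norm_add_le _ _
        _ = _ := by rw [l1norm_smul]; simp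
    set X := Real.sqrt p₀ * l2norm (g - P.phi μ j) + Real.sqrt p₀ ^ 2 * lam
    have hX : l1norm (g - P.phi μ j) ≤ X := h1.trans (le_add_of_nonneg_right hW)
    refine ⟨?_, ?_⟩
    · have : 0 ≤ (2 * A + 1) * X := mul_nonneg (by linarith) (h0.trans hX)
      linarith
    · calc Q ≤ 2 * u * l1norm (g - P.phi μ j) + 2 * lam * l1norm (g - P.phi μ j) := by
            have := mul_le_mul_of_nonneg_left hle (by positivity : 0 ≤ 2 * lam)
            linarith
        _ ≤ 2 * (A * lam) * X + 2 * lam * X := by gcongr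
        _ = _ := by ring
  · exact (hcs _).trans (le_add_of_nonneg_right hW)

/-! ### Size of the penalty relative to the moment deviations. -/

section Penalty

variable {M : ℝ} {p N : ℕ}

theorem log_pos_of_two_le (hp : 2 ≤ p) : 0 < Real.log p :=
  Real.log_pos (by exact_mod_cast hp)

theorem logRatio_pos (hp : 2 ≤ p) (hN : 0 < N) : 0 < logRatio p N := by
  have := log_pos_of_two_le hp
  have hN' : (0 : ℝ) < N := by exact_mod_cast hN
  unfold logRatio
  positivity

theorem lambdaNode_pos (hM : 0 < M) (hp : 2 ≤ p) (hN : 0 < N) : 0 < lambdaNode M p N := by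
  have := log_pos_of_two_le hp
  have hN' : (0 : ℝ) < N := by exact_mod_cast hN
  unfold lambdaNode
  positivity

theorem lambdaNode_rpow (hM : 0 < M) (hp : 2 ≤ p) (hN : 0 < N) (s : ℝ) :
    lambdaNode M p N ^ s = (16 * M) ^ (s / 2) * logRatio p N ^ (s / 2) := by
  have hr := logRatio_pos hp hN
  have h : lambdaNode M p N = (16 * M * logRatio p N) ^ (1 / 2 : ℝ) := by
    rw [lambdaNode, logRatio, Real.sqrt_eq_rpow, mul_div_assoc]
  rw [h, ← Real.rpow_mul (by positivity), ← Real.mul_rpow (by positivity) hr.le]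
  congr 1
  ring

/-- Isolates the factor `log p` by which the penalty outgrows the stochastic order `√(log p / N)`.
-/
theorem lambdaNode_eq (hM : 0 < M) (hp : 2 ≤ p) :
    lambdaNode M p N = 4 * Real.sqrt M * Real.log p * Real.sqrt (Real.log p / N) := by
  have hl := log_pos_of_two_le hp
  have h : 16 * M * Real.log p ^ 3 / N = (4 * Real.log p) ^ 2 * (M * (Real.log p / N)) := by ring
  rw [lambdaNode, h, Real.sqrt_mul (by positivity), Real.sqrt_sq (by positivity),
    Real.sqrt_mul hM.le]
  ring

/-- If the penalties are bounded and `N → ∞` then `log p / N → 0`. -/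
theorem eventually_sqrt_log_div_le (hM : 0 < M) {p N : ℕ → ℕ} (hp : ∀ n, 2 ≤ p n)
    (hN0 : ∀ n, 0 < N n) (hN : Tendsto N atTop atTop) {b : ℝ}
    (hb : ∀ᶠ n in atTop, lambdaNode M (p n) (N n) ≤ b) {e : ℝ} (he : 0 < e) :
    ∀ᶠ n in atTop, Real.sqrt (Real.log (p n) / N n) ≤ e := by
  -- The cube of `log p / N` is `(log p)³ / N` times `1 / N²`: the first factor is bounded along
  -- with the penalty, the second tends to zero.
  have hlim : Tendsto (fun n => b ^ 2 / (16 * M) * ((N n : ℝ) ^ 2)⁻¹) atTop (𝓝 0) := by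
    have h1 : Tendsto (fun n => ((N n : ℝ) ^ 2)⁻¹) atTop (𝓝 0) :=
      tendsto_inv_atTop_zero.comp
        ((tendsto_pow_atTop (by norm_num)).comp (tendsto_natCast_atTop_atTop.comp hN))
    simpa using h1.const_mul (b ^ 2 / (16 * M))
  filter_upwards [hb, hlim.eventually (gt_mem_nhds (by positivity : (0 : ℝ) < (e ^ 2) ^ 3))]
    with n hbn hn
  have hl := log_pos_of_two_le (hp n)
  have hNn : (0 : ℝ) < N n := by exact_mod_cast hN0 n
  have h1 : 16 * M * Real.log (p n) ^ 3 / N n ≤ b ^ 2 :=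
    Real.sqrt_le_left (by linarith [lambdaNode_pos hM (hp n) (hN0 n)]) |>.1 hbn
  have h2 : (Real.log (p n) / N n) ^ 3 ≤ (e ^ 2) ^ 3 := by
    calc (Real.log (p n) / N n) ^ 3
        = 16 * M * Real.log (p n) ^ 3 / N n / (16 * M) * ((N n : ℝ) ^ 2)⁻¹ := by field_simp
      _ ≤ b ^ 2 / (16 * M) * ((N n : ℝ) ^ 2)⁻¹ := by gcongr
      _ ≤ _ := hn.le
  have h3 : Real.log (p n) / N n ≤ e ^ 2 := le_of_pow_le_pow_left₀ (by norm_num) (by positivity) h2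
  exact (Real.sqrt_le_left he.le).2 h3

end Penalty

/-! ### Uniform bounds and their translation into stochastic orders. -/

/-- With high probability the nodewise bounds hold simultaneously, with constants not depending
on `n`. -/
theorem exists_eventually_nodewiseBounds
    {Ω : ℕ → Type*} [∀ n, MeasurableSpace (Ω n)]
    {μ : ∀ n, Measure (Ω n)} [∀ n, IsProbabilityMeasure (μ n)]
    {P : ∀ n, DynamicPanel (Ω n)}
    (hN : Tendsto (fun n => (P n).N) atTop atTop) (hp : ∀ n, 2 ≤ (P n).p)
    (hpanel : ∀ n, (P n).PanelAssumption (μ n))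
    {C K : ℝ} (hC : 0 < C) (hK : 0 < K) (htails : ∀ n, (P n).NodewiseTails (μ n) C K)
    {c c' : ℝ} (hc : 0 < c) (hc' : 0 < c') (hmin : ∀ n, c ≤ mineval ((P n).PsiZ (μ n)))
    (hmax : ∀ n, maxeval ((P n).PsiZ (μ n)) ≤ c')
    {H : ∀ n, Finset (P n).Idx} {ϑ : ℝ} (hϑ0 : 0 < ϑ) (hϑ1 : ϑ < 1)
    {Gbar : ℕ → ℝ} (hG0 : ∀ n, 0 < Gbar n)
    (hws : ∀ n, ∀ j ∈ H n, ∑ k, |(P n).phi (μ n) j k| ^ ϑ ≤ Gbar n)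
    {M : ℝ} (hM : 0 < M) {lam : ℕ → ℝ} (hlam : ∀ n, lam n = lambdaNode M (P n).p (P n).N)
    (hG1 : (fun n => Gbar n * lam n ^ (1 - ϑ)) =O[atTop] (fun _ => (1 : ℝ)))
    (hG2 : (fun n => lam n ^ ϑ) =O[atTop] Gbar)
    {φhat : ∀ n (j : (P n).Idx), Ω n → (P n).Others j → ℝ}
    (hφ : ∀ n j ω, (P n).IsNodewiseLasso (lam n) j ω (φhat n j ω)) {ε : ℝ} (hε : 0 < ε) :
    ∃ D : ℝ, 0 < D ∧ ∀ᶠ n in atTop, μ n {ω | ¬ ∀ j ∈ H n, (P n).NodewiseBounds (μ n) (lam n) j ω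
      (φhat n j ω) (Real.sqrt (Gbar n * lam n ^ (-ϑ))) D} ≤ ENNReal.ofReal ε := by
  have hlam0 : ∀ n, 0 < lam n := fun n => by
    rw [hlam]; exact lambdaNode_pos hM (hp n) (P n).N_pos
  have hz : ∀ n i t k l, Integrable (fun ω => (P n).z i t k ω * (P n).z i t l ω) (μ n) :=
    fun n i t k l => (htails n).integrable_mul hC hK (Sum.inl k) (Sum.inl l) i t
  obtain ⟨B, hB, hBn⟩ := hG1.exists_pos
  obtain ⟨b, hb, hbn⟩ := hG2.exists_pos
  have hΓsq : ∀ n, Real.sqrt (Gbar n * lam n ^ (-ϑ)) ^ 2 = Gbar n * lam n ^ (-ϑ) := fun n =>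
    Real.sq_sqrt (mul_nonneg (hG0 n).le (Real.rpow_nonneg (hlam0 n).le _))
  set Γ : ℕ → ℝ := fun n => Real.sqrt (Gbar n * lam n ^ (-ϑ)) with hΓ
  have hΓB : ∀ᶠ n in atTop, Γ n ^ 2 * lam n ≤ B := by
    filter_upwards [hBn.bound] with n hn
    have h1 := (le_abs_self _).trans hn
    rw [norm_one, mul_one] at h1
    calc Γ n ^ 2 * lam n = Gbar n * lam n ^ (1 - ϑ) := by
          rw [hΓsq, mul_assoc]
          nth_rewrite 2 [← Real.rpow_one (lam n)]
          rw [← Real.rpow_add (hlam0 n)]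
          congr 2; ring
      _ ≤ B := h1
  set c₀ := Real.sqrt (1 / b) with hc₀
  have hc₀p : 0 < c₀ := by positivity
  have hΓc : ∀ᶠ n in atTop, c₀ ≤ Γ n := by
    filter_upwards [hbn.bound] with n hn
    refine Real.sqrt_le_sqrt ?_
    have h1 := (le_abs_self _).trans hn
    rw [Real.norm_of_nonneg (hG0 n).le] at h1
    have h2 : 0 < lam n ^ ϑ := Real.rpow_pos_of_pos (hlam0 n) _
    rw [Real.rpow_neg (hlam0 n).le, ← div_eq_mul_inv, div_le_div_iff₀ hb h2]
    linarith
  -- The two growth conditions together bound the penalty: `λ / b ≤ Γ² λ ≤ B`. Convergence of the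
  -- penalty to zero is not used.
  have hlamB : ∀ᶠ n in atTop, lam n ≤ B * b := by
    filter_upwards [hΓB, hΓc] with n h1 h2
    have h3 : 1 / b ≤ Γ n ^ 2 := by
      calc 1 / b = c₀ ^ 2 := (Real.sq_sqrt (by positivity)).symm
        _ ≤ _ := by gcongr
    have h4 : 1 / b * lam n ≤ B := (mul_le_mul_of_nonneg_right h3 (hlam0 n).le).trans h1
    rw [one_div, inv_mul_eq_div, div_le_iff₀ hb] at h4
    exact h4
  obtain ⟨A, u₀, hA, hu₀, hdev⟩ := exists_measure_not_momentsClose_le hC hK hε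
  obtain ⟨η₁, D₁, hη₁, hD₁, hmany⟩ := DynamicPanel.exists_nodewiseBounds_of_weak_sparsity
    hc hc' hc₀p hB hϑ0 hϑ1
  have hl2 : 0 < Real.log 2 := Real.log_pos (by norm_num)
  -- The threshold for `log p` above which `u ≤ η₁ λ`; below it `p` is at most `exp L`.
  set L := A / (4 * Real.sqrt M * η₁) with hL
  have hL0 : 0 < L := by positivity
  obtain ⟨η₂, D₂, hη₂, hD₂, hfew⟩ := DynamicPanel.exists_nodewiseBounds_of_p_le
    (A := A / (4 * Real.sqrt M * Real.log 2)) hc hc' (by positivity)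
    (by positivity : 0 < B * b) (Real.one_le_exp hL0.le)
  set u : ℕ → ℝ := fun n => A * Real.sqrt (Real.log (P n).p / (P n).N) with hu
  have hu0 : ∀ n, 0 ≤ u n := fun n => by positivity
  have hul : ∀ n, u n = A / (4 * Real.sqrt M * Real.log (P n).p) * lam n := fun n => by
    have := log_pos_of_two_le (hp n)
    rw [hlam, lambdaNode_eq hM (hp n), hu]
    field_simp
  have husmall : ∀ e, 0 < e → ∀ᶠ n in atTop, u n ≤ e := fun e he => by
    filter_upwards [eventually_sqrt_log_div_le hM hp (fun n => (P n).N_pos) hN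
      (by simpa only [← hlam] using hlamB) (by positivity : 0 < e / A)] with n hn
    rw [le_div_iff₀ hA] at hn
    simp only [hu]
    linarith
  set p₀ := Real.exp L with hp₀
  have hp₀0 : 0 < p₀ := Real.exp_pos _
  -- The last two terms convert rates in `√p₀` and `p₀` into rates in `Γ` and `Γ²`, using `Γ ≥ c₀`.
  refine ⟨D₁ + D₂ + D₂ * Real.sqrt p₀ / c₀ + D₂ * p₀ / c₀ ^ 2, by positivity, ?_⟩
  have q1 : 0 < D₂ * Real.sqrt p₀ / c₀ := by positivity
  have q2 : 0 < D₂ * p₀ / c₀ ^ 2 := by positivity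
  filter_upwards [hΓB, hΓc, hlamB, husmall u₀ hu₀, husmall η₂ hη₂] with n hB' hc₀' hlB hun1 hun2
  refine le_trans (measure_mono fun ω hω => ?_) (hdev (μ n) (P n) (hp n) (hpanel n) (htails n) hun1)
  simp only [Set.mem_ofPred_eq] at hω ⊢
  refine fun hclose => hω fun j hj => ?_
  have hΓn : 0 < Γ n := hc₀p.trans_le hc₀'
  by_cases hpL : L ≤ Real.log (P n).p
  · have hulam : u n ≤ η₁ * lam n := by
      rw [hul]
      have := hlam0 n
      have hlp := log_pos_of_two_le (hp n)
      gcongr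
      rw [div_le_iff₀ (by positivity)]
      rw [hL, div_le_iff₀ (by positivity)] at hpL
      linarith
    have hmain := hmany (P n) (μ n) (hz n) (hmin n) (hmax n) (Γ n) (lam n) (u n) (Gbar n) j ω
      (φhat n j ω) hc₀' (hlam0 n) (hΓsq n) hB' (hu0 n) hulam (hws n j hj) hclose (hφ n j ω)
    exact hmain.mono (hlam0 n).le (by linarith) (by gcongr; linarith) (by gcongr; linarith)
  · have hpp : ((P n).p : ℝ) ≤ p₀ := by
      rw [hp₀, ← Real.log_le_iff_le_exp (by have := hp n; positivity)]
      exact (not_le.1 hpL).le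
    have hulam : u n ≤ A / (4 * Real.sqrt M * Real.log 2) * lam n := by
      rw [hul]
      have := hlam0 n
      have : Real.log 2 ≤ Real.log (P n).p :=
        Real.log_le_log (by norm_num) (by exact_mod_cast hp n)
      gcongr
    have hmain := hfew (P n) (μ n) (hz n) (hmin n) (hmax n) hpp (lam n) (u n) j ω
      (φhat n j ω) (hlam0 n) hlB (hu0 n) hulam hun2 hclose (hφ n j ω)
    refine hmain.mono (hlam0 n).le (by linarith) ?_ ?_
    · calc D₂ * Real.sqrt p₀ = D₂ * Real.sqrt p₀ / c₀ * c₀ := by field_simp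
        _ ≤ _ := by gcongr; linarith
    · calc D₂ * Real.sqrt p₀ ^ 2 = D₂ * p₀ / c₀ ^ 2 * c₀ ^ 2 := by
            rw [Real.sq_sqrt hp₀0.le]; field_simp
        _ ≤ _ := by gcongr; linarith

/-- Only monotonicity of the measure is used, so neither the estimators nor the bad sets need be
measurable. -/
theorem isBigOp_of_eventually {Ω : ℕ → Type*} [∀ n, MeasurableSpace (Ω n)]
    {μ : ∀ n, Measure (Ω n)} {Good : ℝ → ∀ n, Ω n → Prop}
    (hGood : ∀ ε : ℝ, 0 < ε → ∃ D : ℝ, 0 < D ∧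
      ∀ᶠ n in atTop, μ n {ω | ¬ Good D n ω} ≤ ENNReal.ofReal ε)
    {X : ∀ n, Ω n → ℝ} {r : ℕ → ℝ} {κ : ℝ} (hκ : 0 < κ)
    (hX : ∀ D n ω, Good D n ω → |X n ω| ≤ D * (κ * r n)) : IsBigOp μ X r := by
  intro ε hε
  obtain ⟨D, hD, h⟩ := hGood ε hε
  refine ⟨D * κ, by positivity, h.mono fun n hn => le_trans (measure_mono fun ω hω => ?_) hn⟩
  simp only [Set.mem_ofPred_eq] at hω ⊢
  intro hg
  have := hX D n ω hg
  rw [← mul_assoc] at this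
  linarith

theorem tendsto_measure_of_eventually {Ω : ℕ → Type*} [∀ n, MeasurableSpace (Ω n)]
    {μ : ∀ n, Measure (Ω n)} {Good : ℝ → ∀ n, Ω n → Prop}
    (hGood : ∀ ε : ℝ, 0 < ε → ∃ D : ℝ, 0 < D ∧
      ∀ᶠ n in atTop, μ n {ω | ¬ Good D n ω} ≤ ENNReal.ofReal ε)
    {E : ∀ n, Set (Ω n)} (hE : ∀ D n ω, Good D n ω → ω ∉ E n) :
    Tendsto (fun n => μ n (E n)) atTop (𝓝 0) := by
  rw [ENNReal.tendsto_nhds_zero]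
  intro ε hε
  -- Truncation at `1` handles the extended value `ε = ⊤`, since the hypothesis takes real levels.
  have hm : min ε 1 ≠ ⊤ := ne_top_of_le_ne_top ENNReal.one_ne_top (min_le_right _ _)
  have hpos : 0 < (min ε 1).toReal := ENNReal.toReal_pos (lt_min hε one_pos).ne' hm
  obtain ⟨D, -, h⟩ := hGood _ hpos
  filter_upwards [h] with n hn
  rw [ENNReal.ofReal_toReal hm] at hn
  refine le_trans (measure_mono fun ω hω => ?_) (hn.trans (min_le_left _ _))
  exact fun hg => hE D n ω hg hω

theorem Finset.abs_sup'_le {ι : Type*} {s : Finset ι} (hs : s.Nonempty) {f : ι → ℝ} {b : ℝ}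
    (h0 : ∀ j ∈ s, 0 ≤ f j) (hb : ∀ j ∈ s, f j ≤ b) : |s.sup' hs f| ≤ b := by
  obtain ⟨j, hj⟩ := hs
  rw [abs_of_nonneg ((h0 j hj).trans (Finset.le_sup' f hj))]
  exact Finset.sup'_le _ _ hb

theorem mainTheorem2
    {Ω : ℕ → Type*} [∀ n, MeasurableSpace (Ω n)]
    (μ : ∀ n, Measure (Ω n)) [∀ n, IsProbabilityMeasure (μ n)]
    (P : ∀ n, DynamicPanel (Ω n))
    (hN : Tendsto (fun n => (P n).N) atTop atTop)
    (hp : ∀ n, 2 ≤ (P n).p)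
    -- independence across individuals, predetermined regressors
    (hpanel : ∀ n, (P n).PanelAssumption (μ n))
    -- uniform subgaussianity of the errors and of the regressors
    (hsub : ∃ C K : ℝ, 0 < C ∧ 0 < K ∧
      (∀ n i t, SubgaussianTail (μ n) ((P n).ε i t) C K) ∧
      (∀ n i t l, SubgaussianTail (μ n) ((P n).z i t l) C K))
    -- eigenvalues of the population second moment matrix
    (hmin : ∃ c : ℝ, 0 < c ∧ ∀ n, c ≤ mineval ((P n).PsiZ (μ n)))
    (hmax : ∃ c : ℝ, ∀ n, maxeval ((P n).PsiZ (μ n)) ≤ c)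
    -- uniform subgaussianity of the nodewise regression errors
    (hzeta : ∃ C K : ℝ, 0 < C ∧ 0 < K ∧
      ∀ n j i t, SubgaussianTail (μ n) ((P n).zeta (μ n) j i t) C K)
    -- index sets of interest and weak sparsity
    (H : ∀ n, Finset (P n).Idx) (hH : ∀ n, (H n).Nonempty)
    (ϑ : ℝ) (hϑ0 : 0 < ϑ) (hϑ1 : ϑ < 1)
    (G : ∀ n, (P n).Idx → ℝ) (hG : ∀ n, ∀ j ∈ H n, 0 < G n j)
    (hws : ∀ n, ∀ j ∈ H n, ∑ k, |(P n).phi (μ n) j k| ^ ϑ ≤ G n j)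
    (Gbar : ℕ → ℝ) (hGbar : ∀ n, Gbar n = (H n).sup' (hH n) (G n)) :
    ∃ M₀ : ℝ, 0 < M₀ ∧ ∀ M : ℝ, M₀ ≤ M →
      ∀ (lam r : ℕ → ℝ),
        (∀ n, lam n = lambdaNode M (P n).p (P n).N) →
        (∀ n, r n = logRatio (P n).p (P n).N) →
      -- growth of the weak sparsity bound
      (fun n => Gbar n * lam n ^ (1 - ϑ)) =O[atTop] (fun _ => (1 : ℝ)) →
      (fun n => lam n ^ ϑ) =O[atTop] Gbar →
      -- any version of the nodewise Lasso
      ∀ φhat : ∀ n (j : (P n).Idx), Ω n → (P n).Others j → ℝ,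
        (∀ n j ω, (P n).IsNodewiseLasso (lam n) j ω (φhat n j ω)) →
      ∀ (tauHat2 : ∀ n, (P n).Idx → Ω n → ℝ) (ΘHat : ∀ n, (P n).Idx → Ω n → (P n).Idx → ℝ),
        (∀ n j ω, tauHat2 n j ω = (P n).tauHatSq (lam n) j ω (φhat n j ω)) →
        (∀ n j ω, ΘHat n j ω = (P n).ThetaHat (lam n) j ω (φhat n j ω)) →
      Tendsto (fun n => μ n {ω | ∃ j ∈ H n, tauHat2 n j ω ≤ 0}) atTop (𝓝 0) ∧
      IsBigOp μ
        (fun n ω => (H n).sup' (hH n) fun j => |tauHat2 n j ω - (P n).tauSq (μ n) j|)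
        (fun n => Gbar n ^ (1 / 2 : ℝ) * r n ^ ((2 - ϑ) / 4)) ∧
      IsBigOp μ
        (fun n ω => (H n).sup' (hH n) fun j => 1 / tauHat2 n j ω)
        (fun _ => 1) ∧
      IsBigOp μ
        (fun n ω => (H n).sup' (hH n) fun j =>
          |1 / tauHat2 n j ω - 1 / (P n).tauSq (μ n) j|)
        (fun n => Gbar n ^ (1 / 2 : ℝ) * r n ^ ((2 - ϑ) / 4)) ∧
      IsBigOp μ
        (fun n ω => (H n).sup' (hH n) fun j =>
          l1norm (fun k => ΘHat n j ω k - (P n).ThetaZ (μ n) j k))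
        (fun n => Gbar n * r n ^ ((1 - ϑ) / 2)) ∧
      IsBigOp μ
        (fun n ω => (H n).sup' (hH n) fun j =>
          l2norm (fun k => ΘHat n j ω k - (P n).ThetaZ (μ n) j k))
        (fun n => Gbar n ^ (1 / 2 : ℝ) * r n ^ ((2 - ϑ) / 4)) ∧
      IsBigOp μ
        (fun n ω => (H n).sup' (hH n) fun j => l1norm (ΘHat n j ω))
        (fun n => Gbar n ^ (1 / 2 : ℝ) * r n ^ (-ϑ / 4)) := by
  obtain ⟨C, K, hC, hK, -, htz⟩ := hsub
  obtain ⟨C', K', hC', hK', htζ⟩ := hzeta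
  obtain ⟨c, hc, hmin⟩ := hmin
  obtain ⟨c', hmax⟩ := hmax
  have htails : ∀ n, (P n).NodewiseTails (μ n) (min C C') (max K K') := by
    rintro n i t (k | j)
    · exact (htz n i t k).mono (min_le_left _ _) (le_max_left _ _) hK.le
    · exact (htζ n j i t).mono (min_le_right _ _) (le_max_right _ _) hK'.le
  have hGle : ∀ n, ∀ j ∈ H n, G n j ≤ Gbar n := fun n j hj => by
    rw [hGbar]; exact Finset.le_sup' _ hj
  have hG0 : ∀ n, 0 < Gbar n := fun n =>
    let ⟨j, hj⟩ := hH n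
    (hG n j hj).trans_le (hGle n j hj)
  -- Any positive `M` would serve, because the stochastic constants may depend on `M`; `1` is an
  -- arbitrary choice.
  refine ⟨1, one_pos, fun M hM1 lam r hlam hr hg1 hg2 φhat hφ tauHat2 ΘHat hτ hΘ => ?_⟩
  have hM : 0 < M := one_pos.trans_le hM1
  have hlam0 : ∀ n, 0 < lam n := fun n => by
    rw [hlam]; exact lambdaNode_pos hM (hp n) (P n).N_pos
  have hlamr : ∀ n (s : ℝ), lam n ^ s = (16 * M) ^ (s / 2) * r n ^ (s / 2) := fun n s => by
    rw [hlam, hr]; exact lambdaNode_rpow hM (hp n) (P n).N_pos s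
  -- The upper eigenvalue bound is enlarged to `max c' 1` to make it visibly positive.
  have hGood := fun ε (hε : (0 : ℝ) < ε) => exists_eventually_nodewiseBounds hN hp hpanel
    (lt_min hC hC') (lt_max_of_lt_left hK) htails hc (lt_max_of_lt_right one_pos) hmin
    (fun n => (hmax n).trans (le_max_left c' 1)) hϑ0 hϑ1 hG0
    (fun n j hj => (hws n j hj).trans (hGle n j hj)) hM hlam hg1 hg2 hφ hε
  have hΓ : ∀ n, Real.sqrt (Gbar n * lam n ^ (-ϑ)) = Gbar n ^ (1 / 2 : ℝ) * lam n ^ (-ϑ / 2) :=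
    fun n => by
      rw [Real.sqrt_eq_rpow, Real.mul_rpow (hG0 n).le (Real.rpow_nonneg (hlam0 n).le _),
        ← Real.rpow_mul (hlam0 n).le]
      congr 2; ring
  -- This and the next two identities rewrite `Γ`, `Γ λ` and `Γ² λ` as the stated rates times powers
  -- of `16 M`, which become the constants `κ`.
  have hrate : ∀ n, Real.sqrt (Gbar n * lam n ^ (-ϑ)) =
      (16 * M) ^ (-ϑ / 2 / 2) * (Gbar n ^ (1 / 2 : ℝ) * r n ^ (-ϑ / 4)) := fun n => by
    rw [hΓ, hlamr, show -ϑ / 2 / 2 = -ϑ / 4 by ring]; ring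
  have hrate1 : ∀ n, Real.sqrt (Gbar n * lam n ^ (-ϑ)) * lam n =
      (16 * M) ^ ((1 - ϑ / 2) / 2) * (Gbar n ^ (1 / 2 : ℝ) * r n ^ ((2 - ϑ) / 4)) := fun n => by
    have h : lam n ^ (-ϑ / 2) * lam n = lam n ^ (1 - ϑ / 2) := by
      nth_rewrite 2 [← Real.rpow_one (lam n)]
      rw [← Real.rpow_add (hlam0 n)]; congr 1; ring
    rw [hΓ, mul_assoc, h, hlamr, show (1 - ϑ / 2) / 2 = (2 - ϑ) / 4 by ring]; ring
  have hrate2 : ∀ n, Real.sqrt (Gbar n * lam n ^ (-ϑ)) ^ 2 * lam n =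
      (16 * M) ^ ((1 - ϑ) / 2) * (Gbar n * r n ^ ((1 - ϑ) / 2)) := fun n => by
    have h : lam n ^ (-ϑ) * lam n = lam n ^ (1 - ϑ) := by
      nth_rewrite 2 [← Real.rpow_one (lam n)]
      rw [← Real.rpow_add (hlam0 n)]; congr 1; ring
    rw [Real.sq_sqrt (mul_nonneg (hG0 n).le (Real.rpow_nonneg (hlam0 n).le _)), mul_assoc, h,
      hlamr]
    ring
  have hτ' : ∀ n j, tauHat2 n j = fun ω => (P n).tauHatSq (lam n) j ω (φhat n j ω) :=
    fun n j => funext (hτ n j)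
  have hΘ' : ∀ n j, ΘHat n j = fun ω => (P n).ThetaHat (lam n) j ω (φhat n j ω) :=
    fun n j => funext (hΘ n j)
  simp only [hτ', hΘ']
  refine ⟨tendsto_measure_of_eventually hGood fun D n ω hg => ?_,
    isBigOp_of_eventually hGood (κ := (16 * M) ^ ((1 - ϑ / 2) / 2)) (by positivity)
      fun D n ω hg => ?_,
    isBigOp_of_eventually hGood (κ := 1) one_pos fun D n ω hg => ?_,
    isBigOp_of_eventually hGood (κ := (16 * M) ^ ((1 - ϑ / 2) / 2)) (by positivity)
      fun D n ω hg => ?_,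
    isBigOp_of_eventually hGood (κ := (16 * M) ^ ((1 - ϑ) / 2)) (by positivity)
      fun D n ω hg => ?_,
    isBigOp_of_eventually hGood (κ := (16 * M) ^ ((1 - ϑ / 2) / 2)) (by positivity)
      fun D n ω hg => ?_,
    isBigOp_of_eventually hGood (κ := (16 * M) ^ (-ϑ / 2 / 2)) (by positivity)
      fun D n ω hg => ?_⟩
  · rintro ⟨j, hj, hle⟩
    exact absurd (hg j hj).tauHat_pos (not_lt.2 hle)
  · rw [← hrate1]
    exact Finset.abs_sup'_le _ (fun _ _ => abs_nonneg _) fun j hj => (hg j hj).tau_diff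
  · rw [one_mul, mul_one]
    exact Finset.abs_sup'_le _ (fun j hj => one_div_nonneg.2 (hg j hj).tauHat_pos.le)
      fun j hj => (hg j hj).inv_le
  · rw [← hrate1]
    exact Finset.abs_sup'_le _ (fun _ _ => abs_nonneg _) fun j hj => (hg j hj).inv_diff
  · rw [← hrate2]
    exact Finset.abs_sup'_le _ (fun _ _ => l1norm_nonneg _) fun j hj => (hg j hj).theta_l1
  · rw [← hrate1]
    exact Finset.abs_sup'_le _ (fun _ _ => l2norm_nonneg _) fun j hj => (hg j hj).theta_l2
  · rw [← hrate]
    exact Finset.abs_sup'_le _ (fun _ _ => l1norm_nonneg _) fun j hj => (hg j hj).thetaHat_l1
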